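/- Let $\mathcal O_K$ be a Henselian discrete valuation ring with fraction field $K$, normalized valuation $\nu_K$, and algebraically closed residue field of characteristic different from $2$. Let $K^{\mathrm{sep}}$ be a separable closure of $K$, and write $\nu_K$ also for the unique extension of $\nu_K$ to $K^{\mathrm{sep}}$. \textbf{Mac Lane valuations.} For a valuation $v$ on $K[x]$ extending $\nu_K$, write $f\sim_v g$ if $v(f)=v(g)<v(f-g)$, and $f\mid_v g$ if $g\sim_v fh$ for some $h\in K[x]$. A \emph{key polynomial} over $v$ is a monic nonconstant $\phi\in\mathcal O_K[x]$ such that $\phi\mid_v fg$ implies $\phi\mid_v f$ or $\phi\mid_v g$, and such that $\phi\mid_v f$ implies $\deg\phi\le\deg f$. Let $v_0$ be the Gauss valuation, $v_0(\sum a_ix^i)=\min_i\nu_K(a_i)$. A Mac Lane valuation of inductive length $n$, $$v_n=[v_0,\,v_1(\phi_1)=\lambda_1,\dots,v_n(\phi_n)=\lambda_n],$$ is given by $\phi_i\in\mathcal O_K[x]$ and $\lambda_i\in\mathbb Q$ such that for $1\le i\le n$ the polynomial $\phi_i$ is a key polynomial over $v_{i-1}$, $\lambda_i>v_{i-1}(\phi_i)$,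 and $v_i(\sum_j a_j\phi_i^j)=\min_j\bigl(v_{i-1}(a_j)+j\lambda_i\bigr)$ whenever $\deg a_j<\deg\phi_i$ for all $j$; the degrees $\deg\phi_i$ are required to be strictly increasing, each dividing the next. For $n\ge1$, a \emph{proper key polynomial} over $v_n$ is a key polynomial $f$ over $v_n$ with $\deg f>\deg\phi_n$. \textbf{Discriminant bonus.} For $\alpha\in K^{\mathrm{sep}}$ with (monic) minimal polynomial $f$ over $K$, put $$\mathrm{db}_K(\alpha)=\nu_K(\mathrm{disc} f)-\nu_K(\mathrm{disc}(K(\alpha)/K)),$$ where $\mathrm{disc}(K(\alpha)/K)$ is the discriminant of an $\mathcal O_K$-basis of the integral closure of $\mathcal O_K$ in $K(\alpha)$. \textbf{Proposition.} Let $\alpha\in K^{\mathrm{sep}}$ with $\nu_K(\alpha)>0$, let $f$ be its minimal polynomial over $K$, and let $v_f=[v_0,\,v_1(\phi_1)=\lambda_1,\dots,v_n(\phi_n)=\lambda_n]$ be the Mac Lane valuation over which $f$ is a proper key polynomial. Suppose $n\ge2$ and put $e=\deg(f)/\deg(\phi_n)$. Then $e\ge2$ and $$\mathrm{db}_K(\alpha)\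 \ge\ \begin{cases}2\deg(\phi_n)\lambda_n-1 & \text{if } e=2,\\[2pt] 2\bigl(\lfloor\deg(\phi_n)\lambda_n\rfloor+e-1\bigr) & \text{if } e>2.\end{cases}$$ If equality holds, then $e=n=2$ and $\phi_2$ is Eisenstein. -/

import Mathlib

open Polynomial IntermediateField

namespace MacLane

noncomputable section

section Field

variable (O : Type*) [CommRing O] [IsDomain O] [IsDiscreteValuationRing O]
variable {K : Type*} [Field K] [Algebra O K] [IsFractionRing O K]

/-- The normalized discrete valuation `K^× → ℤ` attached to the discrete valuation ring `O` with
fraction field `K`. It is only used at nonzero elements (its value at `0` is a dummy `0`). -/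
def ordInt (x : K) : ℤ :=
  -WithZero.log ((IsDiscreteValuationRing.maximalIdeal O).valuation K x)

open Classical in
/-- The normalized discrete valuation `ν_K : K → ℤ ∪ {∞}`, regarded as taking values in
`ℚ ∪ {∞}`. -/
def ord (x : K) : WithTop ℚ :=
  if x = 0 then ⊤ else ((ordInt O x : ℚ) : WithTop ℚ)

/-- The Gauss valuation: the minimum of the valuations of the coefficients. -/
def gauss (f : K[X]) : WithTop ℚ :=
  f.support.inf fun i => ord O (f.coeff i)

end Field

section Augmentation

variable {K : Type*} [Field K]

/-- The coefficient of `φ ^ i` in the `φ`-adic expansion of `f` (for `φ` monic, nonconstant). -/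
def digit (φ f : K[X]) (i : ℕ) : K[X] :=
  (f /ₘ φ ^ i) %ₘ φ

/-- The augmented valuation `[v, v'(φ) = lam]`, which sends `f = ∑ aᵢ φ ^ i` with
`deg aᵢ < deg φ` to the minimum of the `v(aᵢ) + i * lam`. -/
def augment (v : K[X] → WithTop ℚ) (φ : K[X]) (lam : ℚ) (f : K[X]) : WithTop ℚ :=
  (Finset.range (f.natDegree + 1)).inf fun i =>
    v (digit φ f i) + (((i : ℚ) * lam : ℚ) : WithTop ℚ)

/-- `v`-equivalence: `f` and `g` have the same initial term with respect to `v`. -/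
def VEquiv (v : K[X] → WithTop ℚ) (f g : K[X]) : Prop :=
  v f = v g ∧ v f < v (f - g)

/-- `v`-divisibility: `g` is `v`-equivalent to a multiple of `f`. -/
def VDvd (v : K[X] → WithTop ℚ) (f g : K[X]) : Prop :=
  ∃ h : K[X], VEquiv v g (f * h)

/-- Key polynomials over `v` (in the sense of Mac Lane): monic nonconstant polynomials with
integral coefficients that are `v`-irreducible and `v`-minimal. -/
structure IsKeyPoly (O : Type*) [CommRing O] [Algebra O K]
    (v : K[X] → WithTop ℚ) (φ : K[X]) : Prop where
  monic : φ.Monic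
  natDegree_pos : 0 < φ.natDegree
  integral : φ ∈ Polynomial.lifts (algebraMap O K)
  irreducible : ∀ f g : K[X], VDvd v φ (f * g) → VDvd v φ f ∨ VDvd v φ g
  minimal : ∀ f : K[X], VDvd v φ f → φ.natDegree ≤ f.natDegree

end Augmentation

section Inductive

variable (O : Type*) [CommRing O] [IsDomain O] [IsDiscreteValuationRing O]
variable {K : Type*} [Field K] [Algebra O K] [IsFractionRing O K]

/-- The truncation `v_i = [v_0, v_1(φ 1) = lam 1, …, v_i(φ i) = lam i]`.
Only the entries of `φ` and `lam` with index in `{1, …, i}` matter. -/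
def val (φ : ℕ → K[X]) (lam : ℕ → ℚ) : ℕ → K[X] → WithTop ℚ
  | 0 => gauss O
  | i + 1 => augment (val φ lam i) (φ (i + 1)) (lam (i + 1))

/-- `[v_0, v_1(φ 1) = lam 1, …, v_n(φ n) = lam n]` is a Mac Lane valuation, presented with key
polynomials of strictly increasing degrees; `n` is then its inductive valuation length. -/
structure IsMacLane (n : ℕ) (φ : ℕ → K[X]) (lam : ℕ → ℚ) : Prop where
  key : ∀ i < n, IsKeyPoly O (val O φ lam i) (φ (i + 1))
  val_lt : ∀ i < n, val O φ lam i (φ (i + 1)) < (lam (i + 1) : WithTop ℚ)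
  natDegree_dvd : ∀ i, 1 ≤ i → i < n → (φ i).natDegree ∣ (φ (i + 1)).natDegree
  natDegree_lt : ∀ i, 1 ≤ i → i < n → (φ i).natDegree < (φ (i + 1)).natDegree

/-- `f` is a proper key polynomial over `[v_0, …, v_n(φ n) = lam n]`. -/
def IsProperKeyPoly (n : ℕ) (φ : ℕ → K[X]) (lam : ℕ → ℚ) (f : K[X]) : Prop :=
  IsKeyPoly O (val O φ lam n) f ∧ (n = 0 ∨ (φ n).natDegree < f.natDegree)

/-- A polynomial over `K` that is monic with coefficients in `O` and Eisenstein at the maximal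
ideal of `O`. -/
def IsEisenstein (φ : K[X]) : Prop :=
  ∃ g : O[X], g.map (algebraMap O K) = φ ∧ g.Monic ∧
    g.IsEisensteinAt (IsLocalRing.maximalIdeal O)

end Inductive

section Discriminant

variable (O : Type*) [CommRing O] [IsDomain O] [IsDiscreteValuationRing O]
variable (K : Type*) [Field K] [Algebra O K] [IsFractionRing O K]

/-- The discriminant of a finite separable extension `L / K`: the discriminant of the trace form
on an `O`-basis of the integral closure of `O` in `L` (well defined up to squares of units of
`O`). -/
def fieldDiscr (L : Type*) [Field L] [Algebra K L] [Algebra O L] [IsScalarTower O K L]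
    [FiniteDimensional K L] [Algebra.IsSeparable K L] : K :=
  haveI : Module.Finite O (integralClosure O L) :=
    IsIntegralClosure.finite O K L (integralClosure O L)
  haveI : Module.IsTorsionFree O K := inferInstance
  haveI : Module.IsTorsionFree O L := Module.IsTorsionFree.trans_faithfulSMul O K L
  haveI : Module.Free O (integralClosure O L) :=
    IsIntegralClosure.module_free O K L (integralClosure O L)
  Algebra.discr K fun i =>
    ((Module.Free.chooseBasis O (integralClosure O L) i : integralClosure O L) : L)

/-- The discriminant bonus `db_K(α) = ν_K(disc f) - ν_K(disc(K(α)/K))`, where `f` is the minimal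
polynomial of `α` over `K`. -/
def discBonus {Ω : Type*} [Field Ω] [Algebra K Ω] [Algebra O Ω] [IsScalarTower O K Ω]
    [Algebra.IsSeparable K Ω] (α : Ω) : ℤ :=
  haveI : FiniteDimensional K K⟮α⟯ :=
    adjoin.finiteDimensional (Algebra.IsSeparable.isIntegral K α)
  haveI : Algebra.IsSeparable K K⟮α⟯ := inferInstance
  ordInt O (minpoly K α).discr - ordInt O (fieldDiscr O K K⟮α⟯)

/-- The lower bound for the discriminant bonus, in terms of `e = deg f / deg φ_n` and
`x = deg(φ_n) * λ_n`. -/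
def bonusBound (e x : ℚ) : ℚ :=
  if e = 2 then 2 * x - 1 else 2 * ((⌊x⌋ : ℚ) + e - 1)

end Discriminant

end

end MacLane

/-! Since the residue field is algebraically closed, every link of a Mac Lane chain is totally
ramified. Put d_i = deg φ_i and let r_i be the denominator of d_i λ_i (`ramIdx`). Up to a factor of
small degree and a power of φ_i, the initial form of a key polynomial of degree > d_i over v_i is a
polynomial in y = φ_i^{r_i} b, where b has small degree and y has value 0. That polynomial splits
over the residue field, so v-irreducibility forces the next key polynomial to have degree r_i d_i
and value r_i λ_i (`Augmentable.natDegree_eq_of_isKeyPoly`, `KeyChain.natDegree_succ`).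

The bonus is bounded by exhibiting integral elements of K(α). Writing m < deg f as Σ m_i d_i with
m_i < r_i gives a monic G_m = ∏ φ_i^{m_i} of degree m. At each root β of f, v_i(g) ≤ w(g(β))
(`KeyChain.val_le`), so w(G_m(β)) ≥ x_m = Σ m_i λ_i and π^{-⌊x_m⌋} G_m(α) is integral for a
uniformizer π. These elements are triangular in the powers of α, so db ≥ 2 Σ ⌊x_m⌋ (`le_discBonus`).
The x_m are distinct modulo 1 in (1/d)ℤ with d = deg f, so their fractional parts are exactly 0,
1/d, …, (d-1)/d, and 2 Σ ⌊x_m⌋ equals D_n (`chainBonus`), where D_0 = 0 and D_i = r_i D_{i-1} + (r_i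
- 1)(r_i d_i λ_i - 1).

Let e = r_n and x = d_n λ_n. For e = 2, D_n = 2 D_{n-1} + 2x - 1, so equality needs D_{n-1} = 0. As
D_i > 0 for i ≥ 2, this gives n = 2 and r_1 λ_1 = 1. Then φ_2 has a value of valuation 1 at the root
of φ_1, which has positive valuation, so φ_2 is Eisenstein (`KeyChain.isEisenstein`). For e ≥ 3 the
last summand of D_n alone exceeds the bound, because x > 2 (`bonus_lt_of_three_le`). -/

namespace MacLane

/-! ### φ-adic expansions. -/

section Digits

variable {K : Type*} [Field K] {φ : K[X]}

theorem add_divByMonic (hφ : φ.Monic) (f g : K[X]) : (f + g) /ₘ φ = f /ₘ φ + g /ₘ φ := by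
  refine (div_modByMonic_unique _ (f %ₘ φ + g %ₘ φ) hφ ⟨?_, ?_⟩).1
  · linear_combination modByMonic_add_div f φ + modByMonic_add_div g φ
  · exact (degree_add_le _ _).trans_lt
      (max_lt (degree_modByMonic_lt _ hφ) (degree_modByMonic_lt _ hφ))

theorem C_mul_divByMonic (hφ : φ.Monic) (t : K) (f : K[X]) :
    (C t * f) /ₘ φ = C t * (f /ₘ φ) := by
  refine (div_modByMonic_unique _ (C t * (f %ₘ φ)) hφ ⟨?_, ?_⟩).1
  · linear_combination C t * modByMonic_add_div f φ
  · rw [← smul_eq_C_mul]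
    exact (degree_smul_le _ _).trans_lt (degree_modByMonic_lt _ hφ)

theorem divByMonic_divByMonic (hφ : φ.Monic) {ψ : K[X]} (hψ : ψ.Monic) (f : K[X]) :
    (f /ₘ ψ) /ₘ φ = f /ₘ (ψ * φ) := by
  symm
  refine (div_modByMonic_unique _ (f %ₘ ψ + ψ * ((f /ₘ ψ) %ₘ φ)) (hψ.mul hφ) ⟨?_, ?_⟩).1
  · linear_combination modByMonic_add_div f ψ + ψ * modByMonic_add_div (f /ₘ ψ) φ
  · have h0 : φ.degree ≥ 0 := zero_le_degree_iff.2 hφ.ne_zero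
    refine (degree_add_le _ _).trans_lt (max_lt ?_ ?_)
    · rw [degree_mul]
      exact (degree_modByMonic_lt _ hψ).trans_le (le_add_of_nonneg_right h0)
    · rw [degree_mul, degree_mul]
      have h1 : ψ.degree ≠ ⊥ := fun h => hψ.ne_zero (degree_eq_bot.1 h)
      exact WithBot.add_lt_add_left h1 (degree_modByMonic_lt _ hφ)

theorem digit_add (hφ : φ.Monic) (f g : K[X]) (i : ℕ) :
    digit φ (f + g) i = digit φ f i + digit φ g i := by
  rw [digit, add_divByMonic (hφ.pow i), add_modByMonic, digit, digit]

theorem digit_C_mul (hφ : φ.Monic) (t : K) (f : K[X]) (i : ℕ) :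
    digit φ (C t * f) i = C t * digit φ f i := by
  rw [digit, C_mul_divByMonic (hφ.pow i), ← smul_eq_C_mul, smul_modByMonic, digit, smul_eq_C_mul]

theorem digit_sub (hφ : φ.Monic) (f g : K[X]) (i : ℕ) :
    digit φ (f - g) i = digit φ f i - digit φ g i := by
  have := digit_add hφ (f - g) g i
  rw [sub_add_cancel] at this
  rw [this, add_sub_cancel_right]

theorem ne_one_of_natDegree_pos (h : 0 < φ.natDegree) : φ ≠ 1 := by
  rintro rfl
  simp at h

theorem natDegree_digit_lt (hφ : φ.Monic) (h : 0 < φ.natDegree) (f : K[X]) (i : ℕ) :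
    (digit φ f i).natDegree < φ.natDegree :=
  natDegree_modByMonic_lt _ hφ (ne_one_of_natDegree_pos h)

theorem digit_succ (hφ : φ.Monic) (f : K[X]) (i : ℕ) :
    digit φ f (i + 1) = digit φ (f /ₘ φ) i := by
  rw [digit, digit, divByMonic_divByMonic (hφ.pow i) hφ, pow_succ']

theorem digit_eq_zero_of_natDegree_lt (hφ : φ.Monic) {f : K[X]} {i : ℕ}
    (hi : f.natDegree < i * φ.natDegree) : digit φ f i = 0 := by
  rw [digit, (divByMonic_eq_zero_iff (hφ.pow i)).2, zero_modByMonic]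
  apply degree_lt_degree
  rwa [natDegree_pow]

theorem digit_mul_pow_add (hφ : φ.Monic) (f : K[X]) (i j : ℕ) :
    digit φ (φ ^ j * f) (i + j) = digit φ f i := by
  induction j with
  | zero => simp
  | succ j ih =>
    rw [← add_assoc, digit_succ hφ, pow_succ', mul_assoc, mul_divByMonic_cancel_left _ hφ, ih]

theorem digit_mul_pow_of_lt (hφ : φ.Monic) (f : K[X]) {i j : ℕ} (hij : i < j) :
    digit φ (φ ^ j * f) i = 0 := by
  obtain ⟨k, rfl⟩ := Nat.exists_eq_add_of_lt hij
  have : φ ^ (i + k + 1) * f = φ ^ i * (φ ^ (k + 1) * f) := by ring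
  have h0 := digit_mul_pow_add hφ (φ ^ (k + 1) * f) 0 i
  rw [zero_add] at h0
  rw [this, h0, digit, pow_zero, divByMonic_one, pow_succ, mul_right_comm, mul_self_modByMonic hφ]

theorem digit_of_natDegree_lt (hφ : φ.Monic) {a : K[X]} (ha : a.natDegree < φ.natDegree) (i : ℕ) :
    digit φ a i = if i = 0 then a else 0 := by
  split_ifs with h
  · rw [h, digit, pow_zero, divByMonic_one, (modByMonic_eq_self_iff hφ).2 (degree_lt_degree ha)]
  · refine digit_eq_zero_of_natDegree_lt hφ (ha.trans_le ?_)
    exact Nat.le_mul_of_pos_left _ (Nat.pos_of_ne_zero h)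

theorem digit_pow_mul_of_natDegree_lt (hφ : φ.Monic) {a : K[X]}
    (ha : a.natDegree < φ.natDegree) (i j : ℕ) :
    digit φ (φ ^ j * a) i = if i = j then a else 0 := by
  rcases lt_or_ge i j with h | h
  · rw [digit_mul_pow_of_lt hφ _ h, if_neg h.ne]
  · obtain ⟨k, rfl⟩ := Nat.exists_eq_add_of_le' h
    rw [digit_mul_pow_add hφ, digit_of_natDegree_lt hφ ha]
    simp

theorem sum_digit_add (hφ : φ.Monic) (f : K[X]) (n : ℕ) :
    ∑ i ∈ Finset.range n, φ ^ i * digit φ f i + φ ^ n * (f /ₘ φ ^ n) = f := by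
  induction n with
  | zero => simp
  | succ n ih =>
    rw [Finset.sum_range_succ]
    conv_rhs => rw [← ih]
    have h := modByMonic_add_div (f /ₘ φ ^ n) φ
    rw [divByMonic_divByMonic hφ (hφ.pow n), ← pow_succ] at h
    rw [digit]
    linear_combination φ ^ n * h

theorem sum_digit (hφ : φ.Monic) {f : K[X]} {n : ℕ} (hn : f.natDegree < n * φ.natDegree) :
    ∑ i ∈ Finset.range n, φ ^ i * digit φ f i = f := by
  conv_rhs => rw [← sum_digit_add hφ f n]
  rw [(divByMonic_eq_zero_iff (hφ.pow n)).2, mul_zero, add_zero]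
  apply degree_lt_degree
  rwa [natDegree_pow]

theorem natDegree_lt_succ_mul (h : 0 < φ.natDegree) (f : K[X]) :
    f.natDegree < (f.natDegree + 1) * φ.natDegree :=
  (Nat.lt_succ_self _).trans_le (Nat.le_mul_of_pos_right _ h)

/-- The leading digit of a monic polynomial whose degree is a multiple of that of `φ`. -/
theorem digit_of_natDegree_eq (hφ : φ.Monic) (h : 0 < φ.natDegree) {f : K[X]} (hf : f.Monic)
    {r : ℕ} (hr : f.natDegree = r * φ.natDegree) : digit φ f r = 1 := by
  have h1 : f = (f - φ ^ r) + φ ^ r * 1 := by ring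
  have h1' : (1 : K[X]).natDegree < φ.natDegree := by simpa using h
  rw [h1, digit_add hφ, digit_pow_mul_of_natDegree_lt hφ h1', if_pos rfl]
  convert zero_add _
  have hdeg : f.degree = (φ ^ r).degree := by
    rw [degree_eq_natDegree hf.ne_zero, degree_eq_natDegree (hφ.pow r).ne_zero, natDegree_pow, hr]
  rw [digit, (divByMonic_eq_zero_iff (hφ.pow r)).2, zero_modByMonic]
  rw [← hdeg]
  exact degree_sub_lt_left hdeg hf.ne_zero (by rw [hf.leadingCoeff, (hφ.pow r).leadingCoeff])

end Digits

/-! ### Augmented valuations are valuations. -/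

section Augment

variable {K : Type*} [Field K]

/-- The conditions on a valuation `v` under which `augment v φ lam` is again a valuation. They
only involve polynomials of degree less than that of `φ`. -/
structure Augmentable (v : AddValuation K[X] (WithTop ℚ)) (φ : K[X]) (lam : ℚ) : Prop where
  monic : φ.Monic
  natDegree_pos : 0 < φ.natDegree
  ne_top : ∀ a : K[X], a ≠ 0 → a.natDegree < φ.natDegree → v a ≠ ⊤
  map_mod : ∀ a b : K[X], a.natDegree < φ.natDegree → b.natDegree < φ.natDegree →
    v ((a * b) %ₘ φ) = v a + v b
  lt_map_div : ∀ a b : K[X], a ≠ 0 → b ≠ 0 → a.natDegree < φ.natDegree →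
    b.natDegree < φ.natDegree → v a + v b < v ((a * b) /ₘ φ) + lam

variable {v : AddValuation K[X] (WithTop ℚ)} {φ : K[X]} {lam : ℚ}

/-- The cut-off in `augment` is harmless: the digits beyond it vanish and have value `⊤`. -/
theorem le_augment_iff (hφ : φ.Monic) (h : 0 < φ.natDegree) {f : K[X]} {g : WithTop ℚ} :
    g ≤ augment v φ lam f ↔
      ∀ i : ℕ, g ≤ v (digit φ f i) + (((i : ℚ) * lam : ℚ) : WithTop ℚ) := by
  rw [augment, Finset.le_inf_iff]
  refine ⟨fun H i => ?_, fun H i _ => H i⟩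
  by_cases hi : i < f.natDegree + 1
  · exact H i (Finset.mem_range.2 hi)
  · rw [digit_eq_zero_of_natDegree_lt hφ, v.map_zero, top_add]
    · exact le_top
    · have : f.natDegree < i := by omega
      exact this.trans_le (Nat.le_mul_of_pos_right _ h)

theorem augment_le (hφ : φ.Monic) (h : 0 < φ.natDegree) (f : K[X]) (i : ℕ) :
    augment v φ lam f ≤ v (digit φ f i) + (((i : ℚ) * lam : ℚ) : WithTop ℚ) :=
  (le_augment_iff hφ h).1 le_rfl i

theorem exists_augment_eq (v : K[X] → WithTop ℚ) (φ : K[X]) (lam : ℚ) (f : K[X]) :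
    ∃ i : ℕ, augment v φ lam f = v (digit φ f i) + (((i : ℚ) * lam : ℚ) : WithTop ℚ) := by
  obtain ⟨i, -, hi⟩ := Finset.exists_mem_eq_inf (Finset.range (f.natDegree + 1)) (by simp)
    fun i => v (digit φ f i) + (((i : ℚ) * lam : ℚ) : WithTop ℚ)
  exact ⟨i, hi⟩

theorem augment_of_natDegree_lt (hφ : φ.Monic) (h : 0 < φ.natDegree) {a : K[X]}
    (ha : a.natDegree < φ.natDegree) : augment v φ lam a = v a := by
  apply le_antisymm
  · refine (augment_le hφ h a 0).trans ?_
    rw [digit_of_natDegree_lt hφ ha]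
    simp
  · rw [le_augment_iff hφ h]
    intro i
    rw [digit_of_natDegree_lt hφ ha]
    split_ifs with hi
    · simp [hi]
    · simp

theorem augment_pow_mul (hφ : φ.Monic) (h : 0 < φ.natDegree) (f : K[X]) (j : ℕ) :
    augment v φ lam (φ ^ j * f) = augment v φ lam f + (((j : ℚ) * lam : ℚ) : WithTop ℚ) := by
  apply le_antisymm
  · obtain ⟨i, hi⟩ := exists_augment_eq v φ lam f
    refine (augment_le hφ h _ (i + j)).trans ?_
    rw [digit_mul_pow_add hφ, hi, add_assoc]
    gcongr
    rw [← WithTop.coe_add]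
    apply WithTop.coe_le_coe.2
    push_cast
    linarith
  · rw [le_augment_iff hφ h]
    intro i
    rcases lt_or_ge i j with hij | hij
    · simp [digit_mul_pow_of_lt hφ _ hij]
    · obtain ⟨k, rfl⟩ := Nat.exists_eq_add_of_le' hij
      rw [digit_mul_pow_add hφ]
      have := augment_le (v := v) (lam := lam) hφ h f k
      calc _ ≤ v (digit φ f k) + (((k : ℚ) * lam : ℚ) : WithTop ℚ) +
            (((j : ℚ) * lam : ℚ) : WithTop ℚ) := by gcongr
        _ = _ := by
          rw [add_assoc, ← WithTop.coe_add]
          congr 2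
          push_cast
          ring

theorem min_le_augment_add (hφ : φ.Monic) (h : 0 < φ.natDegree) (f g : K[X]) :
    min (augment v φ lam f) (augment v φ lam g) ≤ augment v φ lam (f + g) := by
  rw [le_augment_iff hφ h]
  intro i
  rw [digit_add hφ]
  rcases le_total (v (digit φ f i)) (v (digit φ g i)) with hle | hle
  · refine (min_le_left _ _).trans ((augment_le hφ h f i).trans ?_)
    gcongr
    exact v.map_le_add le_rfl hle
  · refine (min_le_right _ _).trans ((augment_le hφ h g i).trans ?_)
    gcongr
    exact v.map_le_add hle le_rfl

theorem le_augment_sum (hφ : φ.Monic) (h : 0 < φ.natDegree) {ι : Type*} (s : Finset ι)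
    (F : ι → K[X]) {g : WithTop ℚ} (hg : ∀ i ∈ s, g ≤ augment v φ lam (F i)) :
    g ≤ augment v φ lam (∑ i ∈ s, F i) := by
  classical
  induction s using Finset.induction_on with
  | empty =>
    rw [Finset.sum_empty, augment_of_natDegree_lt hφ h (by simpa using h), v.map_zero]
    exact le_top
  | insert a s ha ih =>
    rw [Finset.sum_insert ha]
    refine le_trans (le_min ?_ ?_) (min_le_augment_add hφ h _ _)
    · exact hg a (by simp)
    · exact ih fun i hi => hg i (by simp [hi])

namespace Augmentable

theorem digit_lt (H : Augmentable v φ lam) (f : K[X]) (i : ℕ) :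
    (digit φ f i).natDegree < φ.natDegree :=
  natDegree_digit_lt H.monic H.natDegree_pos f i

theorem map_eq_top_iff (H : Augmentable v φ lam) {a : K[X]} (ha : a.natDegree < φ.natDegree) :
    v a = ⊤ ↔ a = 0 :=
  ⟨fun h => by_contra fun h0 => H.ne_top a h0 ha h, fun h => h ▸ v.map_zero⟩

theorem natDegree_mul_div_lt (H : Augmentable v φ lam) {a b : K[X]}
    (ha : a.natDegree < φ.natDegree) (hb : b.natDegree < φ.natDegree) :
    ((a * b) /ₘ φ).natDegree < φ.natDegree := by
  rw [natDegree_divByMonic _ H.monic]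
  have := natDegree_mul_le (p := a) (q := b)
  have := H.natDegree_pos
  omega

/-- The product of two digits carries at most once. `map_mod` controls the remainder and
`lt_map_div` the carry. -/
theorem add_le_augment_mul (H : Augmentable v φ lam) {a b : K[X]}
    (ha : a.natDegree < φ.natDegree) (hb : b.natDegree < φ.natDegree) :
    v a + v b ≤ augment v φ lam (a * b) := by
  by_cases ha0 : a = 0
  · rw [ha0, zero_mul, augment_of_natDegree_lt H.monic H.natDegree_pos (by simpa using H.2)]
    simp
  by_cases hb0 : b = 0
  · rw [hb0, mul_zero, augment_of_natDegree_lt H.monic H.natDegree_pos (by simpa using H.2)]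
    simp
  rw [← modByMonic_add_div (a * b) φ]
  refine le_trans (le_min ?_ ?_) (min_le_augment_add H.monic H.natDegree_pos _ _)
  · rw [augment_of_natDegree_lt H.monic H.natDegree_pos, H.map_mod a b ha hb]
    exact natDegree_modByMonic_lt _ H.monic (ne_one_of_natDegree_pos H.natDegree_pos)
  · have := augment_pow_mul (v := v) (lam := lam) H.monic H.natDegree_pos ((a * b) /ₘ φ) 1
    rw [pow_one] at this
    rw [this, augment_of_natDegree_lt H.monic H.natDegree_pos (H.natDegree_mul_div_lt ha hb)]
    have := (H.lt_map_div a b ha0 hb0 ha hb).le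
    simpa using this

theorem add_le_augment (H : Augmentable v φ lam) (f g : K[X]) :
    augment v φ lam f + augment v φ lam g ≤ augment v φ lam (f * g) := by
  have hf := sum_digit H.monic (natDegree_lt_succ_mul H.natDegree_pos f)
  have hg := sum_digit H.monic (natDegree_lt_succ_mul H.natDegree_pos g)
  conv_rhs => rw [← hf, ← hg, Finset.sum_mul_sum]
  refine le_augment_sum H.monic H.natDegree_pos _ _ fun i _ => ?_
  refine le_augment_sum H.monic H.natDegree_pos _ _ fun j _ => ?_
  have : φ ^ i * digit φ f i * (φ ^ j * digit φ g j) =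
    φ ^ (i + j) * (digit φ f i * digit φ g j) := by ring
  rw [this, augment_pow_mul H.monic H.natDegree_pos]
  calc _ ≤ (v (digit φ f i) + (((i : ℚ) * lam : ℚ) : WithTop ℚ)) +
        (v (digit φ g j) + (((j : ℚ) * lam : ℚ) : WithTop ℚ)) :=
        add_le_add (augment_le H.monic H.natDegree_pos f i) (augment_le H.monic H.natDegree_pos g j)
    _ = (v (digit φ f i) + v (digit φ g j)) + ((((i + j : ℕ) : ℚ) * lam : ℚ) : WithTop ℚ) := by
      rw [add_add_add_comm, ← WithTop.coe_add]
      congr 2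
      push_cast
      ring
    _ ≤ _ := by
      gcongr
      exact H.add_le_augment_mul (H.digit_lt f i) (H.digit_lt g j)

theorem augment_ne_top (H : Augmentable v φ lam) {f : K[X]} (hf : f ≠ 0) :
    augment v φ lam f ≠ ⊤ := by
  intro htop
  apply hf
  rw [← sum_digit H.monic (natDegree_lt_succ_mul H.natDegree_pos f)]
  refine Finset.sum_eq_zero fun i _ => ?_
  have h := augment_le (v := v) (lam := lam) H.monic H.natDegree_pos f i
  rw [htop, top_le_iff, WithTop.add_eq_top] at h
  rw [(H.map_eq_top_iff (H.digit_lt f i)).1 (h.resolve_right WithTop.coe_ne_top), mul_zero]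

/-- Splitting off the digits below the first one at which the minimum is attained. -/
theorem exists_first_digit (H : Augmentable v φ lam) {f : K[X]} (hf : f ≠ 0) :
    ∃ (i : ℕ) (F r : K[X]), f = r + φ ^ i * F ∧ augment v φ lam f < augment v φ lam r ∧
      augment v φ lam f = v (F %ₘ φ) + (((i : ℚ) * lam : ℚ) : WithTop ℚ) := by
  classical
  let i := Nat.find (exists_augment_eq v φ lam f)
  have hi : augment v φ lam f = _ := Nat.find_spec (exists_augment_eq v φ lam f)
  refine ⟨i, f /ₘ φ ^ i, f %ₘ φ ^ i, (modByMonic_add_div _ _).symm, ?_, hi⟩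
  obtain ⟨k, hk⟩ := exists_augment_eq v φ lam (f %ₘ φ ^ i)
  have hd : digit φ (f %ₘ φ ^ i) k = if k < i then digit φ f k else 0 := by
    split_ifs with hki
    · have h := digit_add H.monic (f %ₘ φ ^ i) (φ ^ i * (f /ₘ φ ^ i)) k
      rw [modByMonic_add_div, digit_mul_pow_of_lt H.monic _ hki, add_zero] at h
      exact h.symm
    · have h := digit_add H.monic (f %ₘ φ ^ i) (φ ^ i * (f /ₘ φ ^ i)) k
      obtain ⟨l, rfl⟩ := Nat.exists_eq_add_of_le' (not_lt.1 hki)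
      rw [modByMonic_add_div, digit_mul_pow_add H.monic] at h
      have : digit φ f (l + i) = digit φ (f /ₘ φ ^ i) l := by
        rw [digit, digit, divByMonic_divByMonic (H.monic.pow l) (H.monic.pow i), add_comm l i,
          pow_add]
      rw [this] at h
      simpa using h
  rw [hk, hd]
  split_ifs with hki
  · exact lt_of_le_of_ne (augment_le H.monic H.natDegree_pos f k)
      (Nat.find_min (exists_augment_eq v φ lam f) hki)
  · rw [v.map_zero, top_add]
    exact lt_top_iff_ne_top.2 (H.augment_ne_top hf)

/-- The argument of Gauss's lemma. Split both factors at their first initial digits; modulo φ the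
product of the upper parts has exactly the expected value, by `map_mod`. If f g had larger value,
every term of the identity `e` below would exceed that value. -/
theorem augment_mul (H : Augmentable v φ lam) (f g : K[X]) :
    augment v φ lam (f * g) = augment v φ lam f + augment v φ lam g := by
  have hz : augment v φ lam 0 = ⊤ := by
    rw [augment_of_natDegree_lt H.monic H.natDegree_pos (by simpa using H.2), v.map_zero]
  by_cases hf : f = 0
  · rw [hf, zero_mul, hz, top_add]
  by_cases hg : g = 0
  · rw [hg, mul_zero, hz, add_top]
  refine le_antisymm ?_ (H.add_le_augment f g)
  obtain ⟨i, F, r, hF, hr, hi⟩ := H.exists_first_digit hf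
  obtain ⟨j, G, s, hG, hs, hj⟩ := H.exists_first_digit hg
  have hft := H.augment_ne_top hf
  have hgt := H.augment_ne_top hg
  have key : augment v φ lam (φ ^ (i + j) * (F * G)) ≤
      augment v φ lam f + augment v φ lam g := by
    rw [augment_pow_mul H.monic H.natDegree_pos]
    have h0 := augment_le (v := v) (lam := lam) H.monic H.natDegree_pos (F * G) 0
    rw [digit, pow_zero, divByMonic_one] at h0
    have h1 : (F * G) %ₘ φ = ((F %ₘ φ) * (G %ₘ φ)) %ₘ φ := mul_modByMonic F G φ
    have hne := ne_one_of_natDegree_pos H.natDegree_pos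
    rw [h1, H.map_mod _ _ (natDegree_modByMonic_lt _ H.monic hne)
      (natDegree_modByMonic_lt _ H.monic hne)] at h0
    calc _ ≤ v (F %ₘ φ) + v (G %ₘ φ) + ((((0 : ℕ) : ℚ) * lam : ℚ) : WithTop ℚ) +
          ((((i + j : ℕ) : ℚ) * lam : ℚ) : WithTop ℚ) := by gcongr
      _ = _ := by
        rw [hi, hj, add_add_add_comm, add_assoc, ← WithTop.coe_add, ← WithTop.coe_add]
        congr 2
        push_cast
        ring
  by_contra hlt
  rw [not_le] at hlt
  have e : φ ^ (i + j) * (F * G) = f * g + (-r * g + (-(f - r)) * s) := by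
    have e1 : φ ^ i * F = f - r := by rw [hF]; ring
    have e2 : φ ^ j * G = g - s := by rw [hG]; ring
    calc _ = (φ ^ i * F) * (φ ^ j * G) := by ring
      _ = _ := by rw [e1, e2]; ring
  have hneg : ∀ p, augment v φ lam p ≤ augment v φ lam (-p) := by
    intro p
    rw [le_augment_iff H.monic H.natDegree_pos]
    intro k
    have : digit φ (-p) k = -digit φ p k := by
      have := digit_sub H.monic 0 p k
      rwa [zero_sub, show digit φ 0 k = 0 by simp [digit], zero_sub] at this
    rw [this, v.map_neg]
    exact augment_le H.monic H.natDegree_pos p k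
  have b1 : augment v φ lam f + augment v φ lam g < augment v φ lam (-r * g) :=
    (WithTop.add_lt_add_of_lt_of_le hgt (hr.trans_le (hneg r)) le_rfl).trans_le
      (H.add_le_augment _ _)
  have hfr : augment v φ lam f ≤ augment v φ lam (-(f - r)) := by
    refine le_trans ?_ (hneg _)
    rw [sub_eq_add_neg]
    exact le_trans (le_min le_rfl (hr.le.trans (hneg r)))
      (min_le_augment_add H.monic H.natDegree_pos _ _)
  have b2 : augment v φ lam f + augment v φ lam g < augment v φ lam (-(f - r) * s) :=
    (WithTop.add_lt_add_of_le_of_lt hft hfr hs).trans_le (H.add_le_augment _ _)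
  rw [e] at key
  refine absurd key (not_le.2 ?_)
  refine lt_of_lt_of_le (lt_min hlt ?_) (min_le_augment_add H.monic H.natDegree_pos _ _)
  exact lt_of_lt_of_le (lt_min b1 b2) (min_le_augment_add H.monic H.natDegree_pos _ _)

/-- The augmented valuation, as a bundled valuation. -/
noncomputable def valuation (H : Augmentable v φ lam) : AddValuation K[X] (WithTop ℚ) :=
  AddValuation.of (augment v φ lam)
    (by rw [augment_of_natDegree_lt H.monic H.natDegree_pos (by simpa using H.2), v.map_zero])
    (by rw [augment_of_natDegree_lt H.monic H.natDegree_pos (by simpa using H.2), v.map_one])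
    (min_le_augment_add H.monic H.natDegree_pos) H.augment_mul

theorem valuation_apply (H : Augmentable v φ lam) (f : K[X]) :
    H.valuation f = augment v φ lam f := rfl

theorem coe_valuation (H : Augmentable v φ lam) : ⇑H.valuation = augment v φ lam := rfl

end Augmentable

end Augment

end MacLane

namespace MacLane

/-! ### The normalized valuation of K. -/

section Ord

variable (O : Type*) [CommRing O] [IsDomain O] [IsDiscreteValuationRing O]
variable {K : Type*} [Field K] [Algebra O K] [IsFractionRing O K]

theorem ord_of_ne_zero {x : K} (hx : x ≠ 0) : ord O x = ((ordInt O x : ℚ) : WithTop ℚ) :=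
  if_neg hx

theorem adicValuation_ne_zero {x : K} (hx : x ≠ 0) :
    (IsDiscreteValuationRing.maximalIdeal O).valuation K x ≠ 0 :=
  (Valuation.ne_zero_iff _).2 hx

theorem ordInt_mul {x y : K} (hx : x ≠ 0) (hy : y ≠ 0) :
    ordInt O (x * y) = ordInt O x + ordInt O y := by
  rw [ordInt, map_mul, WithZero.log_mul (adicValuation_ne_zero O hx) (adicValuation_ne_zero O hy)]
  simp only [ordInt]
  ring

theorem ordInt_one : ordInt O (1 : K) = 0 := by
  rw [ordInt, map_one, WithZero.log_one, neg_zero]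

theorem ordInt_le_ordInt {x y : K} (hx : x ≠ 0) (hy : y ≠ 0) :
    ordInt O x ≤ ordInt O y ↔ (IsDiscreteValuationRing.maximalIdeal O).valuation K y ≤
      (IsDiscreteValuationRing.maximalIdeal O).valuation K x := by
  rw [ordInt, ordInt, neg_le_neg_iff,
    WithZero.log_le_log (adicValuation_ne_zero O hy) (adicValuation_ne_zero O hx)]

theorem ord_le_ord {x y : K} : ord O x ≤ ord O y ↔
    (IsDiscreteValuationRing.maximalIdeal O).valuation K y ≤
      (IsDiscreteValuationRing.maximalIdeal O).valuation K x := by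
  by_cases hy : y = 0
  · simp [ord, hy]
  by_cases hx : x = 0
  · simp [ord, hx, hy]
  rw [ord_of_ne_zero O hx, ord_of_ne_zero O hy, ← ordInt_le_ordInt O hx hy]
  norm_cast

theorem min_le_ord_add (x y : K) : min (ord O x) (ord O y) ≤ ord O (x + y) := by
  rw [min_le_iff, ord_le_ord, ord_le_ord, ← le_max_iff]
  exact Valuation.map_add _ x y

theorem ord_mul (x y : K) : ord O (x * y) = ord O x + ord O y := by
  by_cases hx : x = 0
  · simp [ord, hx]
  by_cases hy : y = 0
  · simp [ord, hy]
  rw [ord_of_ne_zero O hx, ord_of_ne_zero O hy, ord_of_ne_zero O (mul_ne_zero hx hy),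
    ordInt_mul O hx hy, ← WithTop.coe_add, Int.cast_add]

/-- The normalized valuation of `K`, as a bundled valuation. -/
noncomputable def ordVal : AddValuation K (WithTop ℚ) :=
  AddValuation.of (ord O) (by simp [ord])
    (by rw [ord_of_ne_zero O one_ne_zero, ordInt_one]; rfl)
    (min_le_ord_add O) (ord_mul O)

theorem ordVal_apply (x : K) : ordVal O x = ord O x := rfl

theorem ord_zero : ord O (0 : K) = ⊤ := if_pos rfl

theorem ord_one : ord O (1 : K) = 0 := (ordVal O).map_one

theorem ord_nonneg_iff {x : K} : 0 ≤ ord O x ↔ ∃ a : O, algebraMap O K a = x := by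
  rw [← ord_one O (K := K), ord_le_ord, map_one]
  refine ⟨fun h => IsDiscreteValuationRing.exists_lift_of_le_one h, ?_⟩
  rintro ⟨a, rfl⟩
  exact IsDedekindDomain.HeightOneSpectrum.valuation_le_one _ a

theorem ord_algebraMap_nonneg (a : O) : 0 ≤ ord O (algebraMap O K a) :=
  (ord_nonneg_iff O).2 ⟨a, rfl⟩

theorem ord_algebraMap_pos_iff {a : O} :
    0 < ord O (algebraMap O K a) ↔ a ∈ IsLocalRing.maximalIdeal O := by
  rw [← ord_one O (K := K), ← not_le, ord_le_ord, map_one, not_le]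
  exact IsDedekindDomain.HeightOneSpectrum.valuation_lt_one_iff_mem _ a

theorem exists_ordInt_eq_one (K : Type*) [Field K] [Algebra O K] [IsFractionRing O K] :
    ∃ p : K, p ≠ 0 ∧ ordInt O p = 1 := by
  obtain ⟨p, hp⟩ := (IsDiscreteValuationRing.maximalIdeal O).valuation_exists_uniformizer K
  refine ⟨p, ?_, ?_⟩
  · rintro rfl
    rw [map_zero] at hp
    exact WithZero.exp_ne_zero hp.symm
  · rw [ordInt, hp, WithZero.log_exp]
    norm_num

theorem ordInt_zpow (x : K) (k : ℤ) : ordInt O (x ^ k) = k * ordInt O x := by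
  rw [ordInt, map_zpow₀, WithZero.log_zpow, ordInt]
  simp

theorem exists_ord_eq (K : Type*) [Field K] [Algebra O K] [IsFractionRing O K] (k : ℤ) :
    ∃ p : K, p ≠ 0 ∧ ord O p = ((k : ℚ) : WithTop ℚ) := by
  obtain ⟨p, hp, h1⟩ := exists_ordInt_eq_one O K
  refine ⟨p ^ k, zpow_ne_zero k hp, ?_⟩
  rw [ord_of_ne_zero O (zpow_ne_zero k hp), ordInt_zpow, h1, mul_one]

end Ord

/-! ### The Gauss valuation as an augmentation. -/

section Gauss

variable (O : Type*) [CommRing O] [IsDomain O] [IsDiscreteValuationRing O]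
variable {K : Type*} [Field K] [Algebra O K] [IsFractionRing O K]

/-- The valuation of the value of a polynomial at `0`. -/
noncomputable def evalVal : AddValuation K[X] (WithTop ℚ) :=
  (ordVal O).comap (evalRingHom (0 : K))

theorem evalVal_C (a : K) : evalVal O (C a) = ord O a := by
  change ord O (evalRingHom (0 : K) (C a)) = _
  simp

theorem digit_X (f : K[X]) (i : ℕ) : digit X f i = C (f.coeff i) := by
  induction f using Polynomial.induction_on' with
  | add p q hp hq => rw [digit_add monic_X, hp, hq, coeff_add, C_add]
  | monomial n a =>
    have h : (C a).natDegree < (X : K[X]).natDegree := by simp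
    rw [← C_mul_X_pow_eq_monomial, mul_comm, digit_pow_mul_of_natDegree_lt monic_X h, mul_comm,
      coeff_C_mul_X_pow]
    split_ifs <;> simp

/-- In this form the start of the chain obeys the same lemmas as the later links. That `evalVal` is
infinite at X does no harm, since `Augmentable` at X only tests constants. -/
theorem gauss_eq_augment : (gauss O : K[X] → WithTop ℚ) = augment (evalVal O) X 0 := by
  funext f
  apply le_antisymm
  · rw [le_augment_iff monic_X (by simp)]
    intro i
    rw [digit_X, evalVal_C, mul_zero, WithTop.coe_zero, add_zero]
    by_cases hi : f.coeff i = 0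
    · rw [hi, ord_zero]; exact le_top
    · exact Finset.inf_le (mem_support_iff.2 hi)
  · rw [gauss, Finset.le_inf_iff]
    intro i _
    refine (augment_le monic_X (by simp) f i).trans ?_
    rw [digit_X, evalVal_C, mul_zero, WithTop.coe_zero, add_zero]

theorem augmentable_X : Augmentable (evalVal O) (X : K[X]) 0 where
  monic := monic_X
  natDegree_pos := by simp
  ne_top a ha hd := by
    rw [natDegree_X, Nat.lt_one_iff] at hd
    rw [eq_C_of_natDegree_eq_zero hd] at ha ⊢
    rw [evalVal_C, ← ordVal_apply, AddValuation.ne_top_iff]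
    simpa using ha
  map_mod a b ha hb := by
    rw [natDegree_X, Nat.lt_one_iff] at ha hb
    rw [eq_C_of_natDegree_eq_zero ha, eq_C_of_natDegree_eq_zero hb, ← C_mul,
      (modByMonic_eq_self_iff monic_X).2, C_mul, AddValuation.map_mul]
    exact degree_lt_degree (by rw [natDegree_C]; simp)
  lt_map_div a b ha0 hb0 ha hb := by
    rw [natDegree_X, Nat.lt_one_iff] at ha hb
    rw [eq_C_of_natDegree_eq_zero ha] at ha0 ⊢
    rw [eq_C_of_natDegree_eq_zero hb] at hb0 ⊢
    rw [← C_mul, (divByMonic_eq_zero_iff monic_X).2, AddValuation.map_zero, top_add,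
      ← AddValuation.map_mul, ← C_mul, evalVal_C, lt_top_iff_ne_top, ← ordVal_apply,
      AddValuation.ne_top_iff]
    · simp only [ne_eq, map_eq_zero] at ha0 hb0
      exact mul_ne_zero ha0 hb0
    · exact degree_lt_degree (by rw [natDegree_C]; simp)

end Gauss

/-! ### v-equivalence, v-divisibility and key polynomials. -/

section Key

variable {K : Type*} [Field K] {v : AddValuation K[X] (WithTop ℚ)}

theorem VEquiv.of_lt {f g : K[X]} (h : v f < v (f - g)) : VEquiv v f g :=
  ⟨(v.map_eq_of_lt_sub (by rwa [v.map_sub_swap])).symm, h⟩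

theorem VEquiv.trans {f g h : K[X]} (h₁ : VEquiv v f g) (h₂ : VEquiv v g h) : VEquiv v f h := by
  refine VEquiv.of_lt ?_
  have : f - h = (f - g) + (g - h) := by ring
  rw [this]
  exact v.map_lt_add h₁.2 (h₁.1 ▸ h₂.2)

theorem VEquiv.symm {f g : K[X]} (h : VEquiv v f g) : VEquiv v g f :=
  ⟨h.1.symm, by rw [v.map_sub_swap, ← h.1]; exact h.2⟩

theorem VEquiv.ne_top {f g : K[X]} (h : VEquiv v f g) : v f ≠ ⊤ := h.2.ne_top

theorem VEquiv.refl {f : K[X]} (h : v f ≠ ⊤) : VEquiv v f f :=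
  VEquiv.of_lt (by rw [sub_self, v.map_zero]; exact lt_top_iff_ne_top.2 h)

theorem VEquiv.mul_left {f g : K[X]} (h : VEquiv v f g) {p : K[X]} (hp : v p ≠ ⊤) :
    VEquiv v (p * f) (p * g) := by
  refine VEquiv.of_lt ?_
  rw [← mul_sub, v.map_mul, v.map_mul]
  exact WithTop.add_lt_add_left hp h.2

theorem VDvd.of_vEquiv {φ f g : K[X]} (h : VDvd v φ f) (hfg : VEquiv v f g) : VDvd v φ g :=
  let ⟨p, hp⟩ := h
  ⟨p, hfg.symm.trans hp⟩

theorem VDvd.mul_left {φ f : K[X]} (h : VDvd v φ f) {p : K[X]} (hp : v p ≠ ⊤) :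
    VDvd v φ (p * f) :=
  let ⟨q, hq⟩ := h
  ⟨p * q, by rw [mul_left_comm]; exact hq.mul_left hp⟩

theorem VDvd.self {φ : K[X]} (h : v φ ≠ ⊤) : VDvd v φ φ :=
  ⟨1, by rw [mul_one]; exact .refl h⟩

namespace IsKeyPoly

variable {O : Type*} [CommRing O] [Algebra O K] {φ : K[X]}

/-- Let a b = r + φ q with a, b of degree below deg φ; then φ does not v-divide a b. If φ q had
smaller value than a b, then r would be v-equivalent to φ(-q), against minimality. If r had larger
value, a b would be v-equivalent to φ q. -/
theorem augmentable (hk : IsKeyPoly O v φ) (htop : ∀ f : K[X], f ≠ 0 → v f ≠ ⊤) {lam : ℚ}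
    (hlam : v φ < lam) : Augmentable v φ lam := by
  have main : ∀ a b : K[X], a ≠ 0 → b ≠ 0 → a.natDegree < φ.natDegree →
      b.natDegree < φ.natDegree →
      v ((a * b) %ₘ φ) = v (a * b) ∧ v (a * b) ≤ v (φ * ((a * b) /ₘ φ)) := by
    intro a b ha0 hb0 ha hb
    have hnot : ¬ VDvd v φ (a * b) := fun h => (hk.irreducible a b h).elim
      (fun h => (hk.minimal a h).not_gt ha) (fun h => (hk.minimal b h).not_gt hb)
    have hdiv := modByMonic_add_div (a * b) φ
    set p := a * b
    set q := p /ₘ φ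
    set r := p %ₘ φ with hrdef
    have h1 : v p ≤ v (φ * q) := by
      by_contra! hlt
      have hr : r = p - φ * q := by linear_combination hdiv
      have hvr : v r = v (φ * q) := by rw [hr, v.map_sub_eq_of_lt_right hlt]
      have : VDvd v φ r := ⟨-q, VEquiv.of_lt (by
        have : r - φ * -q = p := by linear_combination hdiv
        rw [this, hvr]
        exact hlt)⟩
      exact (hk.minimal r this).not_gt
        (natDegree_modByMonic_lt _ hk.monic (ne_one_of_natDegree_pos hk.natDegree_pos))
    refine ⟨le_antisymm ?_ ?_, h1⟩
    · by_contra! hlt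
      refine hnot ⟨q, VEquiv.of_lt ?_⟩
      have : p - φ * q = r := by linear_combination -hdiv
      rwa [this]
    · have hr : r = p - φ * q := by linear_combination hdiv
      rw [hr]
      exact v.map_le_sub le_rfl h1
  refine ⟨hk.monic, hk.natDegree_pos, fun a ha _ => htop a ha, ?_, ?_⟩
  · intro a b ha hb
    by_cases ha0 : a = 0
    · simp [ha0]
    by_cases hb0 : b = 0
    · simp [hb0]
    rw [(main a b ha0 hb0 ha hb).1, v.map_mul]
  · intro a b ha0 hb0 ha hb
    rw [← v.map_mul]
    by_cases hq : (a * b) /ₘ φ = 0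
    · rw [hq, v.map_zero, top_add]
      exact lt_top_iff_ne_top.2 (htop _ (mul_ne_zero ha0 hb0))
    refine (main a b ha0 hb0 ha hb).2.trans_lt ?_
    rw [v.map_mul, add_comm]
    exact WithTop.add_lt_add_left (htop _ hq) hlam

theorem exists_vDvd_of_prod (hk : IsKeyPoly O v φ) (s : Multiset K[X])
    (h : VDvd v φ s.prod) : ∃ f ∈ s, VDvd v φ f := by
  induction s using Multiset.induction_on with
  | empty =>
    have := hk.minimal _ h
    simp at this
    exact absurd this hk.natDegree_pos.ne'
  | cons a s ih =>
    rw [Multiset.prod_cons] at h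
    rcases hk.irreducible _ _ h with h | h
    · exact ⟨a, by simp, h⟩
    · obtain ⟨f, hf, hd⟩ := ih h
      exact ⟨f, by simp [hf], hd⟩

theorem vDvd_of_pow (hk : IsKeyPoly O v φ) {f : K[X]} {n : ℕ}
    (h : VDvd v φ (f ^ n)) : VDvd v φ f := by
  induction n with
  | zero =>
    have := hk.minimal _ h
    simp at this
    exact absurd this hk.natDegree_pos.ne'
  | succ n ih =>
    rw [pow_succ] at h
    exact (hk.irreducible _ _ h).elim ih id

end IsKeyPoly

end Key

end MacLane

namespace MacLane

/-! ### Total ramification and residual polynomials. -/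

section EvalAt

variable {O : Type*} [CommRing O] {K : Type*} [Field K] [Algebra O K]

/-- The evaluation of polynomials over `O` at a polynomial over `K`. -/
noncomputable def evalAt (O : Type*) [CommRing O] {K : Type*} [Field K] [Algebra O K] (y : K[X]) :
    O[X] →+* K[X] :=
  eval₂RingHom ((C : K →+* K[X]).comp (algebraMap O K)) y

theorem evalAt_monomial (y : K[X]) (i : ℕ) (t : O) :
    evalAt O y (monomial i t) = C (algebraMap O K t) * y ^ i := by
  simp [evalAt]

theorem evalAt_C (y : K[X]) (t : O) : evalAt O y (C t) = C (algebraMap O K t) := by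
  simp [evalAt]

theorem evalAt_X (y : K[X]) : evalAt O y X = y := by
  simp [evalAt]

end EvalAt

variable (O : Type*) [CommRing O] [IsDomain O] [IsDiscreteValuationRing O]
variable {K : Type*} [Field K] [Algebra O K] [IsFractionRing O K]

/-- On polynomials of degree less than `d`, the valuation `v` takes exactly the values `k / d`
with `k` an integer, and has no residue extension over `O`. -/
structure TotallyRamified (v : AddValuation K[X] (WithTop ℚ)) (d : ℕ) : Prop where
  map_C : ∀ t : K, v (C t) = ord O t
  exists_int : ∀ a : K[X], a ≠ 0 → a.natDegree < d → ∃ k : ℤ, v a = ((k / d : ℚ) : WithTop ℚ)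
  exists_poly : ∀ k : ℤ, ∃ a : K[X], a ≠ 0 ∧ a.natDegree < d ∧ v a = ((k / d : ℚ) : WithTop ℚ)
  exists_scalar : ∀ a b : K[X], a ≠ 0 → b ≠ 0 → a.natDegree < d → b.natDegree < d → v a = v b →
    ∃ t : O, v a < v (a - C (algebraMap O K t) * b)

variable {O}
variable {v : AddValuation K[X] (WithTop ℚ)} {φ : K[X]} {lam : ℚ}

theorem lam_eq {d : ℕ} (hd : 0 < d) (lam : ℚ) :
    lam = ((d * lam).num : ℚ) / ((d * lam).den * d) := by
  have hd' : (d : ℚ) ≠ 0 := by exact_mod_cast hd.ne'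
  have h := Rat.num_div_den (d * lam)
  rw [← div_div, h]
  field_simp

namespace TotallyRamified

/-- A tie puts (i - j) lam into the value group (1/deg φ)ℤ, so the denominator of deg φ · lam
divides i - j times the coprime numerator. -/
theorem dvd_sub (S : TotallyRamified O v φ.natDegree) (hd : 0 < φ.natDegree) {a b : K[X]}
    (ha : a ≠ 0) (hb : b ≠ 0) (had : a.natDegree < φ.natDegree) (hbd : b.natDegree < φ.natDegree)
    {i j : ℕ} (h : v a + (((i : ℚ) * lam : ℚ) : WithTop ℚ) =
      v b + (((j : ℚ) * lam : ℚ) : WithTop ℚ)) :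
    (((φ.natDegree * lam).den : ℕ) : ℤ) ∣ (i : ℤ) - j := by
  obtain ⟨k, hk⟩ := S.exists_int a ha had
  obtain ⟨l, hl⟩ := S.exists_int b hb hbd
  rw [hk, hl, ← WithTop.coe_add, ← WithTop.coe_add, WithTop.coe_eq_coe] at h
  have hd' : (φ.natDegree : ℚ) ≠ 0 := by exact_mod_cast hd.ne'
  set x : ℚ := φ.natDegree * lam with hx
  have h1 : ((i : ℚ) - j) * x = l - k := by
    have : (φ.natDegree : ℚ) * (k / φ.natDegree + i * lam) =
      φ.natDegree * (l / φ.natDegree + j * lam) := by rw [h]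
    field_simp at this
    rw [hx]
    linear_combination this
  have h2 : ((i : ℤ) - j) * x.num = (l - k) * x.den := by
    have hden : (x.den : ℚ) ≠ 0 := by exact_mod_cast x.den_ne_zero
    have : ((i : ℚ) - j) * x.num = (l - k) * x.den := by
      rw [← h1, mul_assoc, Rat.mul_den_eq_num]
    exact_mod_cast this
  have hcop : IsCoprime (x.den : ℤ) x.num := by
    rw [Int.isCoprime_iff_gcd_eq_one, Int.gcd_comm]
    exact x.reduced
  exact hcop.dvd_of_dvd_mul_right ⟨l - k, by rw [h2]; ring⟩

end TotallyRamified

namespace Augmentable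

theorem valuation_small (H : Augmentable v φ lam) {a : K[X]} (ha : a.natDegree < φ.natDegree) :
    H.valuation a = v a :=
  augment_of_natDegree_lt H.monic H.natDegree_pos ha

theorem valuation_pow_mul (H : Augmentable v φ lam) (f : K[X]) (j : ℕ) :
    H.valuation (φ ^ j * f) = H.valuation f + (((j : ℚ) * lam : ℚ) : WithTop ℚ) :=
  augment_pow_mul H.monic H.natDegree_pos f j

theorem valuation_le (H : Augmentable v φ lam) (f : K[X]) (i : ℕ) :
    H.valuation f ≤ v (digit φ f i) + (((i : ℚ) * lam : ℚ) : WithTop ℚ) :=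
  augment_le H.monic H.natDegree_pos f i

theorem valuation_ne_top (H : Augmentable v φ lam) {f : K[X]} (hf : f ≠ 0) :
    H.valuation f ≠ ⊤ :=
  H.augment_ne_top hf

theorem valuation_pow_mul_digit (H : Augmentable v φ lam) (f : K[X]) (i : ℕ) :
    H.valuation (φ ^ i * digit φ f i) =
      v (digit φ f i) + (((i : ℚ) * lam : ℚ) : WithTop ℚ) := by
  rw [H.valuation_pow_mul, H.valuation_small (H.digit_lt f i)]

theorem valuation_C (H : Augmentable v φ lam) (t : K) : H.valuation (C t) = v (C t) :=
  H.valuation_small (by simpa using H.natDegree_pos)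

theorem mod_ne_zero (H : Augmentable v φ lam) {a b : K[X]} (ha : a ≠ 0) (hb : b ≠ 0)
    (had : a.natDegree < φ.natDegree) (hbd : b.natDegree < φ.natDegree) : (a * b) %ₘ φ ≠ 0 := by
  intro h0
  have := H.map_mod a b had hbd
  rw [h0, v.map_zero, eq_comm, WithTop.add_eq_top] at this
  exact this.elim (H.ne_top a ha had) (H.ne_top b hb hbd)

theorem vEquiv_mod (H : Augmentable v φ lam) {a b : K[X]} (ha : a ≠ 0) (hb : b ≠ 0)
    (had : a.natDegree < φ.natDegree) (hbd : b.natDegree < φ.natDegree) :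
    VEquiv H.valuation (a * b) ((a * b) %ₘ φ) := by
  refine VEquiv.of_lt ?_
  have h := modByMonic_add_div (a * b) φ
  have e : a * b - (a * b) %ₘ φ = φ ^ 1 * ((a * b) /ₘ φ) := by
    linear_combination -h
  rw [e, H.valuation_pow_mul, H.valuation_small (H.natDegree_mul_div_lt had hbd),
    AddValuation.map_mul, H.valuation_small had, H.valuation_small hbd, Nat.cast_one, one_mul]
  exact H.lt_map_div a b ha hb had hbd

/-- Reducing modulo φ after each multiplication brings products back to small degree, where
`exists_scalar` applies. -/
theorem exists_vEquiv_mul_pow (H : Augmentable v φ lam) {a b : K[X]} (ha : a ≠ 0) (hb : b ≠ 0)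
    (had : a.natDegree < φ.natDegree) (hbd : b.natDegree < φ.natDegree) (n : ℕ) :
    ∃ r : K[X], r ≠ 0 ∧ r.natDegree < φ.natDegree ∧ VEquiv H.valuation (a * b ^ n) r := by
  induction n with
  | zero => exact ⟨a, ha, had, by simpa using VEquiv.refl (H.valuation_ne_top ha)⟩
  | succ n ih =>
    obtain ⟨r, hr, hrd, h⟩ := ih
    refine ⟨(b * r) %ₘ φ, H.mod_ne_zero hb hr hbd hrd, natDegree_modByMonic_lt _ H.monic
      (ne_one_of_natDegree_pos H.natDegree_pos), ?_⟩
    have e : a * b ^ (n + 1) = b * (a * b ^ n) := by ring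
    rw [e]
    exact (h.mul_left (H.valuation_ne_top hb)).trans (H.vEquiv_mod hb hr hbd hrd)

theorem exists_scalar_mul_pow (H : Augmentable v φ lam) (S : TotallyRamified O v φ.natDegree)
    {a b c : K[X]} (ha : a ≠ 0) (hb : b ≠ 0) (hc : c ≠ 0) (had : a.natDegree < φ.natDegree)
    (hbd : b.natDegree < φ.natDegree) (hcd : c.natDegree < φ.natDegree) (n : ℕ)
    (h : H.valuation (a * b ^ n) = v c) :
    ∃ t : O, v c < H.valuation (c - C (algebraMap O K t) * (a * b ^ n)) := by
  obtain ⟨r, hr, hrd, hE⟩ := H.exists_vEquiv_mul_pow ha hb had hbd n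
  have hcr : v c = v r := by rw [← h, hE.1, H.valuation_small hrd]
  obtain ⟨t, ht⟩ := S.exists_scalar c r hc hr hcd hrd hcr
  refine ⟨t, ?_⟩
  have e : c - C (algebraMap O K t) * (a * b ^ n) =
      (c - C (algebraMap O K t) * r) + C (algebraMap O K t) * (r - a * b ^ n) := by ring
  rw [e]
  apply AddValuation.map_lt_add
  · rw [H.valuation_small]
    · exact ht
    · refine (natDegree_sub_le _ _).trans_lt (max_lt hcd ?_)
      exact (natDegree_C_mul_le _ _).trans_lt hrd
  · rw [AddValuation.map_mul, H.valuation_C, S.map_C, ← h, AddValuation.map_sub_swap]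
    exact hE.2.trans_le (le_add_of_nonneg_left (ord_algebraMap_nonneg O t))

theorem pos_evalAt_of_coeff_mem (hC : ∀ t : K, v (C t) = ord O t) {y : K[X]} (hy : v y = 0)
    {p : O[X]} (hp : ∀ i, p.coeff i ∈ IsLocalRing.maximalIdeal O) : 0 < v (evalAt O y p) := by
  rw [p.as_sum_range, map_sum]
  refine v.map_lt_sum WithTop.zero_ne_top fun i _ => ?_
  rw [evalAt_monomial, v.map_mul, v.map_pow, hy, hC, smul_zero, add_zero, ord_algebraMap_pos_iff]
  exact hp i

/-- This is where algebraic closedness of the residue field enters. -/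
theorem exists_lift_splits [IsAlgClosed (IsLocalRing.ResidueField O)] (T : O[X]) :
    ∃ (s : O) (m : Multiset O), ∀ i,
      (T - C s * (m.map fun a => X - C a).prod).coeff i ∈ IsLocalRing.maximalIdeal O := by
  set k := IsLocalRing.ResidueField O
  let res : O →+* k := IsLocalRing.residue O
  -- A set-theoretic section suffices: only the leading coefficient and the roots are lifted.
  obtain ⟨σ, hσ⟩ := (IsLocalRing.residue_surjective (R := O)).hasRightInverse
  let Tb := T.map res
  refine ⟨σ Tb.leadingCoeff, Tb.roots.map σ, fun i => ?_⟩
  rw [← IsLocalRing.residue_eq_zero_iff, ← coeff_map]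
  have hsplit := (IsAlgClosed.splits Tb).eq_prod_roots
  have : (T - C (σ Tb.leadingCoeff) * ((Tb.roots.map σ).map fun a => X - C a).prod).map
      (IsLocalRing.residue O) = 0 := by
    rw [Polynomial.map_sub, Polynomial.map_mul, map_C, hσ, Polynomial.map_multiset_prod,
      Multiset.map_map, Multiset.map_map]
    have e : (Polynomial.map (IsLocalRing.residue O) ∘ fun a => X - C a) ∘ σ =
        fun a => X - C a := by
      funext a
      simp [hσ a]
    rw [e, ← hsplit, sub_self]
  rw [this, coeff_zero]

end Augmentable

end MacLane

namespace MacLane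

/-! ### Degrees and values of key polynomials. -/

section

variable {K : Type*} [Field K] {v : AddValuation K[X] (WithTop ℚ)} {φ : K[X]} {lam : ℚ} {f : K[X]}

namespace Augmentable

theorem digit_ne_zero_of_eq (H : Augmentable v φ lam) (hf : f ≠ 0) {j : ℕ}
    (hj : H.valuation f = v (digit φ f j) + (((j : ℚ) * lam : ℚ) : WithTop ℚ)) :
    digit φ f j ≠ 0 := by
  intro h0
  rw [h0, v.map_zero, top_add] at hj
  exact H.valuation_ne_top hf hj

/-- A key polynomial of degree larger than `φ` has at least two initial terms. -/
theorem exists_ne_digit {O : Type*} [CommRing O] [Algebra O K] (H : Augmentable v φ lam)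
    (hk : IsKeyPoly O H.valuation f) (hdeg : φ.natDegree < f.natDegree) {j : ℕ}
    (hj : H.valuation f = v (digit φ f j) + (((j : ℚ) * lam : ℚ) : WithTop ℚ)) :
    ∃ i, i ≠ j ∧ H.valuation f = v (digit φ f i) + (((i : ℚ) * lam : ℚ) : WithTop ℚ) := by
  by_contra! hne
  have hf := hk.monic.ne_zero
  -- With a single initial term, f would v-divide φ or a digit, both of smaller degree.
  have hE : VEquiv H.valuation f (φ ^ j * digit φ f j) := by
    refine VEquiv.of_lt ?_
    have hs := sum_digit H.monic (natDegree_lt_succ_mul H.natDegree_pos f)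
    have hmem : j ∈ Finset.range (f.natDegree + 1) := by
      rw [Finset.mem_range]
      by_contra hlt
      refine H.digit_ne_zero_of_eq hf hj (digit_eq_zero_of_natDegree_lt H.monic ?_)
      exact (not_lt.1 hlt).trans (Nat.le_mul_of_pos_right _ H.natDegree_pos)
    have e : f - φ ^ j * digit φ f j =
        ∑ i ∈ (Finset.range (f.natDegree + 1)).erase j, φ ^ i * digit φ f i := by
      rw [← Finset.add_sum_erase _ _ hmem] at hs
      linear_combination -hs
    rw [e]
    refine AddValuation.map_lt_sum _ (H.valuation_ne_top hf) fun i hi => ?_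
    rw [H.valuation_pow_mul_digit]
    exact lt_of_le_of_ne (H.valuation_le f i) (hne i (Finset.ne_of_mem_erase hi))
  have hd := (VDvd.self (H.valuation_ne_top hf)).of_vEquiv hE
  rcases hk.irreducible _ _ hd with h | h
  · exact (hk.minimal _ (hk.vDvd_of_pow h)).not_gt hdeg
  · exact (hk.minimal _ h).not_gt ((H.digit_lt f j).trans hdeg)

end Augmentable

end

variable {O : Type*} [CommRing O] [IsDomain O] [IsDiscreteValuationRing O]
variable {K : Type*} [Field K] [Algebra O K] [IsFractionRing O K]
variable {v : AddValuation K[X] (WithTop ℚ)} {φ : K[X]} {lam : ℚ} {f : K[X]}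

namespace Augmentable

/-- Initial indices have the form j₀ + e i by `dvd_sub`. The digit there has the value of the j₀-th
digit times b^i, so it agrees with a scalar multiple of that product up to higher value. Thus each
initial term is a scalar times φ^{j₀} a_{j₀} y^i, and T collects the scalars. -/
theorem vEquiv_evalAt (H : Augmentable v φ lam) (S : TotallyRamified O v φ.natDegree)
    (hf : f ≠ 0) {j₀ : ℕ}
    (hj₀ : H.valuation f = v (digit φ f j₀) + (((j₀ : ℚ) * lam : ℚ) : WithTop ℚ))
    (hmin : ∀ j, H.valuation f = v (digit φ f j) + (((j : ℚ) * lam : ℚ) : WithTop ℚ) → j₀ ≤ j)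
    {b : K[X]} (hb : b ≠ 0) (hbd : b.natDegree < φ.natDegree)
    (hvb : v b = ((-((φ.natDegree * lam).den * lam) : ℚ) : WithTop ℚ)) :
    ∃ T : O[X], VEquiv H.valuation f
      (φ ^ j₀ * digit φ f j₀ * evalAt O (φ ^ (φ.natDegree * lam).den * b) T) := by
  set e := (φ.natDegree * lam).den with he
  set y := φ ^ e * b with hy
  have ha₀ := H.digit_ne_zero_of_eq hf hj₀
  have key : ∀ j, ∃ p : O[X], H.valuation f < H.valuation
      (φ ^ j * digit φ f j - φ ^ j₀ * digit φ f j₀ * evalAt O y p) := by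
    intro j
    by_cases hj : H.valuation f = v (digit φ f j) + (((j : ℚ) * lam : ℚ) : WithTop ℚ)
    · have ha := H.digit_ne_zero_of_eq hf hj
      have hdvd := S.dvd_sub H.natDegree_pos ha ha₀ (H.digit_lt f j) (H.digit_lt f j₀)
        (lam := lam) (hj.symm.trans hj₀)
      rw [← he, ← Nat.cast_sub (hmin j hj), Int.natCast_dvd_natCast] at hdvd
      obtain ⟨i, hi⟩ := hdvd
      have hji : j = j₀ + e * i := by have := hmin j hj; omega
      have hval : H.valuation (digit φ f j₀ * b ^ i) = v (digit φ f j) := by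
        rw [AddValuation.map_mul, AddValuation.map_pow, H.valuation_small hbd,
          H.valuation_small (H.digit_lt f j₀), hvb, ← WithTop.coe_nsmul]
        rw [hj₀] at hj
        obtain ⟨q₀, hq₀⟩ := WithTop.ne_top_iff_exists.1 (H.ne_top _ ha₀ (H.digit_lt f j₀))
        obtain ⟨q, hq⟩ := WithTop.ne_top_iff_exists.1 (H.ne_top _ ha (H.digit_lt f j))
        rw [← hq₀, ← hq, ← WithTop.coe_add, ← WithTop.coe_add, WithTop.coe_eq_coe] at hj
        rw [← hq₀, ← hq, ← WithTop.coe_add, WithTop.coe_eq_coe]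
        have : (j : ℚ) = j₀ + e * i := by exact_mod_cast hji
        rw [this] at hj
        rw [nsmul_eq_mul]
        linear_combination hj
      obtain ⟨t, ht⟩ := H.exists_scalar_mul_pow S ha₀ hb ha (H.digit_lt f j₀) hbd (H.digit_lt f j)
        i hval
      refine ⟨monomial i t, ?_⟩
      have e1 : φ ^ j * digit φ f j - φ ^ j₀ * digit φ f j₀ * evalAt O y (monomial i t) =
          φ ^ j * (digit φ f j - C (algebraMap O K t) * (digit φ f j₀ * b ^ i)) := by
        rw [evalAt_monomial, hy, hji, pow_add, pow_mul, mul_pow]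
        ring
      rw [e1, H.valuation_pow_mul, hj]
      exact WithTop.add_lt_add_right WithTop.coe_ne_top ht
    · refine ⟨0, ?_⟩
      rw [map_zero, mul_zero, sub_zero, H.valuation_pow_mul_digit]
      exact lt_of_le_of_ne (H.valuation_le f j) hj
  choose p hp using key
  refine ⟨∑ j ∈ Finset.range (f.natDegree + 1), p j, VEquiv.of_lt ?_⟩
  have hs := sum_digit H.monic (natDegree_lt_succ_mul H.natDegree_pos f)
  have e2 : f - φ ^ j₀ * digit φ f j₀ * evalAt O y (∑ j ∈ Finset.range (f.natDegree + 1), p j) =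
      ∑ j ∈ Finset.range (f.natDegree + 1),
        (φ ^ j * digit φ f j - φ ^ j₀ * digit φ f j₀ * evalAt O y (p j)) := by
    rw [Finset.sum_sub_distrib, hs, map_sum, Finset.mul_sum]
  rw [e2]
  exact AddValuation.map_lt_sum _ (H.valuation_ne_top hf) fun j _ => hp j

/-- Since the residue field is algebraically closed, a key polynomial divides a polynomial of the
form `y - s`, with `s` a scalar. -/
theorem exists_vDvd_sub_C [IsAlgClosed (IsLocalRing.ResidueField O)] (H : Augmentable v φ lam)
    (S : TotallyRamified O v φ.natDegree) (hk : IsKeyPoly O H.valuation f)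
    (hdeg : φ.natDegree < f.natDegree) {b : K[X]} (hb : b ≠ 0) (hbd : b.natDegree < φ.natDegree)
    (hvb : v b = ((-((φ.natDegree * lam).den * lam) : ℚ) : WithTop ℚ)) :
    ∃ s : O, VDvd H.valuation f (φ ^ (φ.natDegree * lam).den * b - C (algebraMap O K s)) := by
  classical
  have hf := hk.monic.ne_zero
  have hex := exists_augment_eq v φ lam f
  set j₀ := Nat.find hex
  have hj₀ : H.valuation f = v (digit φ f j₀) + (((j₀ : ℚ) * lam : ℚ) : WithTop ℚ) :=
    Nat.find_spec hex
  have ha₀ := H.digit_ne_zero_of_eq hf hj₀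
  obtain ⟨T, hT⟩ := H.vEquiv_evalAt S hf hj₀ (fun j hj => Nat.find_min' hex hj) hb hbd hvb
  set e := (φ.natDegree * lam).den
  set y := φ ^ e * b with hy
  have hvy : H.valuation y = 0 := by
    rw [hy, H.valuation_pow_mul, H.valuation_small hbd, hvb, ← WithTop.coe_add]
    simp
  have hC : ∀ t : K, H.valuation (C t) = ord O t := fun t => by rw [H.valuation_C, S.map_C]
  obtain ⟨s, m, hm⟩ := exists_lift_splits T
  set P : O[X] := C s * (m.map fun a => X - C a).prod with hP
  have hpos := pos_evalAt_of_coeff_mem hC hvy hm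
  have hq : H.valuation (φ ^ j₀ * digit φ f j₀) = H.valuation f := by
    rw [H.valuation_pow_mul_digit, hj₀]
  have hT0 : H.valuation (evalAt O y T) = 0 := by
    have := hT.1
    rw [AddValuation.map_mul, hq] at this
    have h2 : H.valuation f + 0 = H.valuation f + H.valuation (evalAt O y T) := by
      rw [add_zero]; exact this
    exact ((WithTop.add_left_inj (H.valuation_ne_top hf)).1 h2).symm
  have hTP : VEquiv H.valuation (evalAt O y T) (evalAt O y P) := by
    refine VEquiv.of_lt ?_
    rw [hT0, ← map_sub]
    exact hpos
  have hne : H.valuation (φ ^ j₀ * digit φ f j₀) ≠ ⊤ := by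
    rw [hq]; exact H.valuation_ne_top hf
  have hd := (VDvd.self (H.valuation_ne_top hf)).of_vEquiv (hT.trans (hTP.mul_left hne))
  rcases hk.irreducible _ _ hd with h | h
  · exfalso
    rcases hk.irreducible _ _ h with h | h
    · exact (hk.minimal _ (hk.vDvd_of_pow h)).not_gt hdeg
    · exact (hk.minimal _ h).not_gt ((H.digit_lt f j₀).trans hdeg)
  · rw [hP, map_mul, evalAt_C, map_multiset_prod, Multiset.map_map] at h
    rcases hk.irreducible _ _ h with h | h
    · exfalso
      have := hk.minimal _ h
      rw [natDegree_C] at this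
      omega
    · obtain ⟨g, hg, hgd⟩ := hk.exists_vDvd_of_prod _ h
      obtain ⟨a, -, rfl⟩ := Multiset.mem_map.1 hg
      refine ⟨a, ?_⟩
      simpa [evalAt_C, evalAt_X] using hgd

/-- Here c has the value opposite to b, and t c b is v-equivalent to 1. Multiplying φ^e b - s by t c
turns it into φ^e - t s c, still v-divisible by f and of degree at most e deg φ; minimality of f
concludes. -/
theorem natDegree_le_of_isKeyPoly [IsAlgClosed (IsLocalRing.ResidueField O)]
    (H : Augmentable v φ lam) (S : TotallyRamified O v φ.natDegree)
    (hk : IsKeyPoly O H.valuation f) (hdeg : φ.natDegree < f.natDegree) :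
    f.natDegree ≤ (φ.natDegree * lam).den * φ.natDegree := by
  have hd0 := H.natDegree_pos
  have hd' : (φ.natDegree : ℚ) ≠ 0 := by exact_mod_cast hd0.ne'
  set e := (φ.natDegree * lam).den with he
  have helam : (e : ℚ) * lam = (φ.natDegree * lam).num / φ.natDegree := by
    rw [← Rat.mul_den_eq_num, ← he]
    field_simp
  obtain ⟨b, hb, hbd, hvb⟩ := S.exists_poly (-(φ.natDegree * lam).num)
  rw [Int.cast_neg, neg_div, ← helam] at hvb
  obtain ⟨c, hc, hcd, hvc⟩ := S.exists_poly (φ.natDegree * lam).num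
  rw [← helam] at hvc
  obtain ⟨s, hs⟩ := H.exists_vDvd_sub_C S hk hdeg hb hbd hvb
  have h1d : (1 : K[X]).natDegree < φ.natDegree := by simpa using hd0
  have hcb : H.valuation (c * b ^ 1) = v 1 := by
    rw [pow_one, AddValuation.map_mul, H.valuation_small hcd, H.valuation_small hbd, hvb, hvc,
      ← WithTop.coe_add, v.map_one]
    simp
  obtain ⟨t, ht⟩ := H.exists_scalar_mul_pow S hc hb one_ne_zero hcd hbd h1d 1 hcb
  rw [v.map_one, pow_one] at ht
  have hvt : H.valuation (C (algebraMap O K t)) = 0 := by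
    have h1 := H.valuation.map_eq_of_lt_sub (x := 1) (y := C (algebraMap O K t) * (c * b))
      (by rwa [AddValuation.map_one, AddValuation.map_sub_swap])
    rw [pow_one, v.map_one] at hcb
    rw [AddValuation.map_mul, hcb, add_zero, AddValuation.map_one] at h1
    exact h1
  have hy0 : H.valuation (φ ^ e * b - C (algebraMap O K s)) ≤ 0 := by
    refine (H.valuation_le _ e).trans ?_
    rw [digit_sub H.monic, digit_pow_mul_of_natDegree_lt H.monic hbd, if_pos rfl,
      digit_of_natDegree_lt H.monic (by simpa using hd0), if_neg (Rat.den_ne_zero _), sub_zero, hvb,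
      ← WithTop.coe_add]
    simp
  have hE : VEquiv H.valuation (C (algebraMap O K t) * c * (φ ^ e * b - C (algebraMap O K s)))
      (φ ^ e - C (algebraMap O K t) * C (algebraMap O K s) * c) := by
    refine VEquiv.of_lt ?_
    have e1 : C (algebraMap O K t) * c * (φ ^ e * b - C (algebraMap O K s)) -
        (φ ^ e - C (algebraMap O K t) * C (algebraMap O K s) * c) =
        φ ^ e * (C (algebraMap O K t) * (c * b) - 1) := by ring
    rw [e1, H.valuation_pow_mul, AddValuation.map_sub_swap, AddValuation.map_mul,
      AddValuation.map_mul, hvt, zero_add, H.valuation_small hcd, hvc, add_comm]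
    exact WithTop.add_lt_add_right WithTop.coe_ne_top (hy0.trans_lt ht)
  have hne : H.valuation (C (algebraMap O K t) * c) ≠ ⊤ := by
    rw [AddValuation.map_mul, hvt, zero_add]
    exact H.valuation_ne_top hc
  refine (hk.minimal _ ((hs.mul_left hne).of_vEquiv hE)).trans ?_
  refine (natDegree_sub_le _ _).trans (max_le (natDegree_pow_le) ?_)
  rw [← C_mul]
  refine (natDegree_C_mul_le _ _).trans (hcd.le.trans ?_)
  exact Nat.le_mul_of_pos_left _ (Rat.den_pos _)

/-- The shape of a key polynomial `f` of degree larger than `φ`: its degree is `e * deg φ` with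
`e` the order of `lam` modulo the value group, and its first and last digits are initial. -/
theorem natDegree_eq_of_isKeyPoly [IsAlgClosed (IsLocalRing.ResidueField O)]
    (H : Augmentable v φ lam) (S : TotallyRamified O v φ.natDegree)
    (hk : IsKeyPoly O H.valuation f) (hdeg : φ.natDegree < f.natDegree) :
    f.natDegree = (φ.natDegree * lam).den * φ.natDegree ∧
    H.valuation f = (((φ.natDegree * lam).den * lam : ℚ) : WithTop ℚ) ∧
    v (f %ₘ φ) = (((φ.natDegree * lam).den * lam : ℚ) : WithTop ℚ) := by
  have hf := hk.monic.ne_zero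
  have hle := H.natDegree_le_of_isKeyPoly S hk hdeg
  set e := (φ.natDegree * lam).den with he
  -- Two initial indices differ by a multiple of e and neither exceeds e, so they are 0 and e.
  have main : ∀ i j, i < j →
      H.valuation f = v (digit φ f i) + (((i : ℚ) * lam : ℚ) : WithTop ℚ) →
      H.valuation f = v (digit φ f j) + (((j : ℚ) * lam : ℚ) : WithTop ℚ) →
      f.natDegree = e * φ.natDegree ∧ i = 0 ∧ j = e := by
    intro i j hij hi hj
    have hdvd := S.dvd_sub H.natDegree_pos (H.digit_ne_zero_of_eq hf hj)
      (H.digit_ne_zero_of_eq hf hi) (H.digit_lt f j) (H.digit_lt f i)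
        (lam := lam) (hj.symm.trans hi)
    rw [← he, ← Nat.cast_sub hij.le, Int.natCast_dvd_natCast] at hdvd
    have h1 := Nat.le_of_dvd (by omega) hdvd
    have h2 : j * φ.natDegree ≤ f.natDegree := by
      by_contra! hlt
      exact H.digit_ne_zero_of_eq hf hj (digit_eq_zero_of_natDegree_lt H.monic hlt)
    have h3 : j ≤ e := Nat.le_of_mul_le_mul_right (h2.trans hle) H.natDegree_pos
    have h4 : j = e := by omega
    exact ⟨le_antisymm hle (h4 ▸ h2), by omega, h4⟩
  obtain ⟨j₀, hj₀⟩ := exists_augment_eq v φ lam f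
  obtain ⟨j₁, hne, hj₁⟩ := H.exists_ne_digit hk hdeg hj₀
  have concl : ∀ i j, i < j →
      H.valuation f = v (digit φ f i) + (((i : ℚ) * lam : ℚ) : WithTop ℚ) →
      H.valuation f = v (digit φ f j) + (((j : ℚ) * lam : ℚ) : WithTop ℚ) →
      f.natDegree = e * φ.natDegree ∧ H.valuation f = ((e * lam : ℚ) : WithTop ℚ) ∧
        v (f %ₘ φ) = ((e * lam : ℚ) : WithTop ℚ) := by
    intro i j hij hi hj
    obtain ⟨hd, rfl, rfl⟩ := main i j hij hi hj
    rw [digit_of_natDegree_eq H.monic H.natDegree_pos hk.monic hd, v.map_one, zero_add] at hj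
    refine ⟨hd, hj, ?_⟩
    rw [digit, pow_zero, divByMonic_one, hj] at hi
    simpa using hi.symm
  rcases lt_or_gt_of_ne hne with h | h
  · exact concl _ _ h hj₁ hj₀
  · exact concl _ _ h hj₀ hj₁

/-- Below degree e deg φ only indices less than e occur. They are incongruent modulo e, so the
initial digit is unique and determined by the value; each claim reduces to that digit. -/
theorem totallyRamified (H : Augmentable v φ lam) (S : TotallyRamified O v φ.natDegree) :
    TotallyRamified O H.valuation ((φ.natDegree * lam).den * φ.natDegree) := by
  have hd0 := H.natDegree_pos
  have hd' : (φ.natDegree : ℚ) ≠ 0 := by exact_mod_cast hd0.ne'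
  set x : ℚ := φ.natDegree * lam with hx
  have he' : (x.den : ℚ) ≠ 0 := by exact_mod_cast x.den_ne_zero
  have hlam : lam = x.num / (x.den * φ.natDegree) := lam_eq hd0 lam
  have hdig : ∀ a : K[X], a.natDegree < x.den * φ.natDegree → ∀ j, x.den ≤ j → digit φ a j = 0 :=
    fun a ha j hj => digit_eq_zero_of_natDegree_lt H.monic
      (ha.trans_le (Nat.mul_le_mul_right _ hj))
  have huniq : ∀ a b : K[X], a ≠ 0 → b ≠ 0 → a.natDegree < x.den * φ.natDegree →
      b.natDegree < x.den * φ.natDegree → ∀ i j,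
      H.valuation a = v (digit φ a i) + (((i : ℚ) * lam : ℚ) : WithTop ℚ) →
      H.valuation a = v (digit φ b j) + (((j : ℚ) * lam : ℚ) : WithTop ℚ) →
      i = j := by
    intro a b ha hb had hbd i j hi hj
    have hai := H.digit_ne_zero_of_eq ha hi
    have hbj : digit φ b j ≠ 0 := by
      intro h0
      rw [h0, v.map_zero, top_add] at hj
      exact H.valuation_ne_top ha hj
    have hdvd := S.dvd_sub hd0 hai hbj (H.digit_lt a i) (H.digit_lt b j)
        (lam := lam) (hi.symm.trans hj)
    have hi' : i < x.den := by
      by_contra! h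
      exact hai (hdig a had i h)
    have hj' : j < x.den := by
      by_contra! h
      exact hbj (hdig b hbd j h)
    rw [← hx] at hdvd
    have : (i : ℤ) - j = 0 := Int.eq_zero_of_abs_lt_dvd hdvd (by rw [abs_lt]; omega)
    omega
  refine ⟨fun t => by rw [H.valuation_C, S.map_C], ?_, ?_, ?_⟩
  · intro a ha had
    obtain ⟨j, hj⟩ := exists_augment_eq v φ lam a
    obtain ⟨k, hk⟩ := S.exists_int _ (H.digit_ne_zero_of_eq ha hj) (H.digit_lt a j)
    refine ⟨k * x.den + j * x.num, ?_⟩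
    rw [H.valuation_apply, hj, hk, ← WithTop.coe_add, WithTop.coe_eq_coe, hlam]
    push_cast
    field_simp
  · intro k
    have hcop : IsCoprime x.num (x.den : ℤ) := by
      rw [Int.isCoprime_iff_gcd_eq_one]
      exact x.reduced
    -- Bézout writes k = (k p) num + (k q) den. The exponent of φ is k p reduced modulo den, and the
    -- quotient is absorbed into the value of `a`.
    obtain ⟨p, q, hpq⟩ := hcop
    have hden : (0 : ℤ) < x.den := by exact_mod_cast x.den_pos
    set j := ((k * p) % x.den).toNat with hj
    have hj0 := Int.emod_nonneg (k * p) hden.ne'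
    have hj1 := Int.emod_lt_of_pos (k * p) hden
    have hjj : (j : ℤ) = (k * p) % x.den := Int.toNat_of_nonneg hj0
    obtain ⟨a, ha, had, hva⟩ := S.exists_poly (k * q + ((k * p) / x.den) * x.num)
    refine ⟨φ ^ j * a, mul_ne_zero (pow_ne_zero _ H.monic.ne_zero) ha, ?_, ?_⟩
    · rw [natDegree_mul (pow_ne_zero _ H.monic.ne_zero) ha, natDegree_pow]
      have : j + 1 ≤ x.den := by omega
      nlinarith
    · rw [H.valuation_pow_mul, H.valuation_small had, hva, ← WithTop.coe_add, WithTop.coe_eq_coe,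
        hlam]
      have h1 : (j : ℤ) + x.den * ((k * p) / x.den) = k * p := by
        rw [hjj]; exact Int.emod_add_mul_ediv _ _
      have h1' : (j : ℚ) + x.den * (((k * p) / x.den : ℤ) : ℚ) = k * p := by exact_mod_cast h1
      have hpq' : (p : ℚ) * x.num + q * x.den = 1 := by exact_mod_cast hpq
      push_cast
      field_simp
      linear_combination x.num * h1' + k * hpq'
  · intro a b ha hb had hbd hab
    obtain ⟨i, hi⟩ := exists_augment_eq v φ lam a
    obtain ⟨j, hj⟩ := exists_augment_eq v φ lam b
    obtain rfl : i = j := huniq a b ha hb had hbd i j hi (hab.trans hj)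
    have hai := H.digit_ne_zero_of_eq ha hi
    have hbi := H.digit_ne_zero_of_eq hb hj
    have hvi : v (digit φ a i) = v (digit φ b i) := by
      refine (WithTop.add_right_inj (WithTop.coe_ne_top (a := (i : ℚ) * lam))).1 ?_
      rw [← hi, ← hj]
      exact hab
    obtain ⟨t, ht⟩ := S.exists_scalar _ _ hai hbi (H.digit_lt a i) (H.digit_lt b i) hvi
    refine ⟨t, ?_⟩
    obtain ⟨k, hk⟩ := exists_augment_eq v φ lam (a - C (algebraMap O K t) * b)
    rw [H.valuation_apply (a - _), hk, digit_sub H.monic, digit_C_mul H.monic]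
    by_cases hki : k = i
    · rw [hki, H.valuation_apply, hi]
      exact WithTop.add_lt_add_right WithTop.coe_ne_top ht
    · have h1 : H.valuation a < v (digit φ a k) + (((k : ℚ) * lam : ℚ) : WithTop ℚ) :=
        lt_of_le_of_ne (H.valuation_le a k) fun h => hki (huniq a a ha ha had had i k hi h).symm
      have h2 : H.valuation a < v (digit φ b k) + (((k : ℚ) * lam : ℚ) : WithTop ℚ) :=
        lt_of_le_of_ne (hab ▸ H.valuation_le b k)
          fun h => hki (huniq a b ha hb had hbd i k hi h).symm
      have h3 : v (digit φ b k) ≤ v (C (algebraMap O K t) * digit φ b k) := by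
        rw [v.map_mul, S.map_C]
        exact le_add_of_nonneg_left (ord_algebraMap_nonneg O t)
      rcases le_total (v (digit φ a k)) (v (C (algebraMap O K t) * digit φ b k)) with h | h
      · refine h1.trans_le ?_
        gcongr
        exact v.map_le_sub le_rfl h
      · refine h2.trans_le ?_
        gcongr
        exact v.map_le_sub (h3.trans h) h3

end Augmentable

end MacLane

namespace MacLane

/-! ### Total ramification at the start of the chain. -/

section Base

variable (O : Type*) [CommRing O] [IsDomain O] [IsDiscreteValuationRing O]
variable (K : Type*) [Field K] [Algebra O K] [IsFractionRing O K]

theorem totallyRamified_evalVal :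
    TotallyRamified O (evalVal O : AddValuation K[X] (WithTop ℚ)) (X : K[X]).natDegree := by
  rw [natDegree_X]
  refine ⟨evalVal_C O, ?_, ?_, ?_⟩
  · intro a ha hd
    rw [Nat.lt_one_iff] at hd
    rw [eq_C_of_natDegree_eq_zero hd] at ha ⊢
    refine ⟨ordInt O (a.coeff 0), ?_⟩
    rw [evalVal_C, ord_of_ne_zero O (by simpa using ha)]
    simp
  · intro k
    obtain ⟨p, hp, h⟩ := exists_ord_eq O K k
    exact ⟨C p, by simpa using hp, by simp, by rw [evalVal_C, h]; simp⟩
  · intro a b ha hb had hbd hab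
    rw [Nat.lt_one_iff] at had hbd
    rw [eq_C_of_natDegree_eq_zero had] at ha hab ⊢
    rw [eq_C_of_natDegree_eq_zero hbd] at hb hab ⊢
    set x := a.coeff 0
    set y := b.coeff 0
    have hx : x ≠ 0 := by simpa using ha
    have hy : y ≠ 0 := by simpa using hb
    rw [evalVal_C, evalVal_C] at hab
    have hxy : 0 ≤ ord O (x / y) := by
      rw [ord_of_ne_zero O (div_ne_zero hx hy)]
      rw [ord_of_ne_zero O hx, ord_of_ne_zero O hy, WithTop.coe_eq_coe, Int.cast_inj] at hab
      have := ordInt_mul O (div_ne_zero hx hy) hy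
      rw [div_mul_cancel₀ x hy] at this
      have h0 : ordInt O (x / y) = 0 := by omega
      rw [h0]
      simp
    obtain ⟨t, ht⟩ := (ord_nonneg_iff O).1 hxy
    refine ⟨t, ?_⟩
    rw [ht, ← C_mul, div_mul_cancel₀ x hy, sub_self, AddValuation.map_zero, evalVal_C,
      ord_of_ne_zero O hx]
    exact WithTop.coe_lt_top _

end Base

/-! ### Numerical invariants of a chain. -/

section Chain

variable (O : Type*) [CommRing O] [IsDomain O] [IsDiscreteValuationRing O]
variable {K : Type*} [Field K] [Algebra O K] [IsFractionRing O K]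

/-- A Mac Lane valuation of length `n`, together with a proper key polynomial `φ (n + 1)`. -/
structure KeyChain (n : ℕ) (φ : ℕ → K[X]) (lam : ℕ → ℚ) : Prop where
  key : ∀ i ≤ n, IsKeyPoly O (val O φ lam i) (φ (i + 1))
  val_lt : ∀ i < n, val O φ lam i (φ (i + 1)) < (lam (i + 1) : WithTop ℚ)
  natDegree_lt : ∀ i < n, (φ (i + 1)).natDegree < (φ (i + 2)).natDegree

/-- The order of `lam i` modulo the value group of the previous valuation. -/
def ramIdx (φ : ℕ → K[X]) (lam : ℕ → ℚ) (i : ℕ) : ℕ := ((φ i).natDegree * lam i).den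

variable {O} {n : ℕ} {φ : ℕ → K[X]} {lam : ℕ → ℚ}

theorem val_congr {φ' : ℕ → K[X]} {i : ℕ} (h : ∀ j ≤ i, φ' j = φ j) :
    val O φ' lam i = val O φ lam i := by
  induction i with
  | zero => rfl
  | succ i ih => rw [val, val, ih fun j hj => h j (by omega), h _ le_rfl]

/-- Appending f as entry n + 1 lets the minimal polynomial be treated as one more key polynomial. -/
theorem IsMacLane.keyChain (hv : IsMacLane O n φ lam) (hn : n ≠ 0) {f : K[X]}
    (hf : IsProperKeyPoly O n φ lam f) : KeyChain O n (Function.update φ (n + 1) f) lam := by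
  have hupd : ∀ j ≤ n, Function.update φ (n + 1) f j = φ j := fun j hj =>
    Function.update_of_ne (by omega) _ _
  have hval : ∀ i ≤ n, val O (Function.update φ (n + 1) f) lam i = val O φ lam i := fun i hi =>
    val_congr fun j hj => hupd j (hj.trans hi)
  refine ⟨fun i hi => ?_, fun i hi => ?_, fun i hi => ?_⟩
  · rw [hval i hi]
    rcases hi.lt_or_eq with h | rfl
    · rw [hupd _ h]
      exact hv.key i h
    · rw [Function.update_self]
      exact hf.1
  · rw [hval i hi.le, hupd _ hi]
    exact hv.val_lt i hi
  · rw [hupd _ hi]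
    rcases Nat.lt_or_ge (i + 1) n with h | h
    · rw [hupd _ h]
      exact hv.natDegree_lt (i + 1) (by omega) h
    · obtain rfl : n = i + 1 := by omega
      rw [Function.update_self]
      exact hf.2.resolve_left hn

namespace KeyChain

theorem isKeyPoly_coe (h : KeyChain O n φ lam) {i : ℕ} (hi : i ≤ n)
    {V : AddValuation K[X] (WithTop ℚ)} (hV : ⇑V = val O φ lam i) : IsKeyPoly O V (φ (i + 1)) := by
  rw [hV]
  exact h.key i hi

theorem natDegree_pos (h : KeyChain O n φ lam) {i : ℕ} (hi : i ≤ n) :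
    0 < (φ (i + 1)).natDegree :=
  (h.key i hi).natDegree_pos

variable [IsAlgClosed (IsLocalRing.ResidueField O)]

theorem exists_valuation (h : KeyChain O n φ lam) : ∀ i ≤ n,
    ∃ V : AddValuation K[X] (WithTop ℚ), ⇑V = val O φ lam i ∧ (∀ f : K[X], f ≠ 0 → V f ≠ ⊤) ∧
      TotallyRamified O V (φ (i + 1)).natDegree ∧ (i = 0 → (φ 1).natDegree = 1) := by
  intro i
  induction i with
  | zero =>
    intro _
    have H := augmentable_X O (K := K)
    have S := totallyRamified_evalVal O K
    have hV : ⇑H.valuation = val O φ lam 0 := (gauss_eq_augment O).symm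
    have hk := h.isKeyPoly_coe (Nat.zero_le n) hV
    -- The Gauss valuation has lam = 0 with denominator 1, so a degree above 1 would be forced to
    -- equal 1.
    have h1 : (φ 1).natDegree = 1 := by
      by_contra hne
      have hpos := hk.natDegree_pos
      have hlt : (X : K[X]).natDegree < (φ 1).natDegree := by
        rw [natDegree_X]
        rw [zero_add] at hpos
        omega
      have := (H.natDegree_eq_of_isKeyPoly S hk hlt).1
      simp at this
      exact hne this
    refine ⟨H.valuation, hV, fun f hf => H.valuation_ne_top hf, ?_, fun _ => h1⟩
    have := H.totallyRamified S
    simpa [h1] using this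
  | succ i ih =>
    intro hi
    obtain ⟨V, hV, htop, S, -⟩ := ih (by omega)
    have H := (h.isKeyPoly_coe (by omega) hV).augmentable htop (by rw [hV]; exact h.val_lt i hi)
    have hV' : ⇑H.valuation = val O φ lam (i + 1) := by
      rw [H.coe_valuation, hV]
      rfl
    have := H.natDegree_eq_of_isKeyPoly S (h.isKeyPoly_coe hi hV') (h.natDegree_lt i hi)
    refine ⟨H.valuation, hV', fun f hf => H.valuation_ne_top hf, ?_, by omega⟩
    rw [this.1]
    exact H.totallyRamified S

theorem natDegree_one (h : KeyChain O n φ lam) : (φ 1).natDegree = 1 := by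
  obtain ⟨V, -, -, -, h1⟩ := h.exists_valuation 0 (Nat.zero_le n)
  exact h1 rfl

theorem exists_augmentable (h : KeyChain O n φ lam) {i : ℕ} (hi : i < n) :
    ∃ V : AddValuation K[X] (WithTop ℚ), ⇑V = val O φ lam i ∧
      Augmentable V (φ (i + 1)) (lam (i + 1)) ∧ TotallyRamified O V (φ (i + 1)).natDegree := by
  obtain ⟨V, hV, htop, S, -⟩ := h.exists_valuation i hi.le
  exact ⟨V, hV, (h.isKeyPoly_coe hi.le hV).augmentable htop (by rw [hV]; exact h.val_lt i hi), S⟩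

theorem natDegree_succ (h : KeyChain O n φ lam) {i : ℕ} (hi : i < n) :
    (φ (i + 2)).natDegree = ramIdx φ lam (i + 1) * (φ (i + 1)).natDegree ∧
    val O φ lam (i + 1) (φ (i + 2)) =
      ((ramIdx φ lam (i + 1) * lam (i + 1) : ℚ) : WithTop ℚ) ∧
    val O φ lam i (φ (i + 2) %ₘ φ (i + 1)) =
      ((ramIdx φ lam (i + 1) * lam (i + 1) : ℚ) : WithTop ℚ) := by
  obtain ⟨V, hV, H, S⟩ := h.exists_augmentable hi
  have hV' : ⇑H.valuation = val O φ lam (i + 1) := by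
    rw [H.coe_valuation, hV]
    rfl
  have := H.natDegree_eq_of_isKeyPoly S (h.isKeyPoly_coe (by omega) hV') (h.natDegree_lt i hi)
  rw [hV', hV] at this
  exact this

theorem two_le_ramIdx (h : KeyChain O n φ lam) {i : ℕ} (hi : i < n) :
    2 ≤ ramIdx φ lam (i + 1) := by
  have h1 := h.natDegree_lt i hi
  rw [(h.natDegree_succ hi).1] at h1
  by_contra! hlt
  have : ramIdx φ lam (i + 1) * (φ (i + 1)).natDegree ≤ 1 * (φ (i + 1)).natDegree :=
    Nat.mul_le_mul_right _ (by omega)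
  omega

theorem ramIdx_mul_lam_lt (h : KeyChain O n φ lam) {i : ℕ} (hi : i + 1 < n) :
    ramIdx φ lam (i + 1) * lam (i + 1) < lam (i + 2) := by
  have := h.val_lt (i + 1) hi
  rw [(h.natDegree_succ (by omega)).2.1] at this
  exact WithTop.coe_lt_coe.1 this

theorem lam_pos (h : KeyChain O n φ lam) {i : ℕ} (hi : i < n) : 0 < lam (i + 1) := by
  induction i with
  | zero =>
    have h1 := h.val_lt 0 hi
    have h0 : (0 : WithTop ℚ) ≤ val O φ lam 0 (φ 1) := by
      change _ ≤ gauss O (φ 1)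
      rw [gauss, Finset.le_inf_iff]
      intro j _
      obtain ⟨g, hg⟩ := (mem_lifts _).1 (h.key 0 hi.le).integral
      rw [zero_add] at hg
      rw [← hg, coeff_map]
      exact ord_algebraMap_nonneg O _
    exact_mod_cast h0.trans_lt h1
  | succ i ih =>
    refine lt_of_le_of_lt ?_ (h.ramIdx_mul_lam_lt hi)
    have := ih (by omega)
    positivity

/-- Descending induction on i. The j-th digit of f with respect to φ_{i+2} has value at least (M -
j) λ_{i+2}. Since φ_{i+2} has value r λ_{i+1} < λ_{i+2} under v_{i+1}, every term of the expansion
has value at least M r λ_{i+1}. -/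
theorem exists_le_val (h : KeyChain O n φ lam) {i : ℕ} (hi : i < n) :
    ∃ M : ℕ, (φ (n + 1)).natDegree = M * (φ (i + 1)).natDegree ∧
      ((M * lam (i + 1) : ℚ) : WithTop ℚ) ≤ val O φ lam (i + 1) (φ (n + 1)) := by
  obtain ⟨k, hk⟩ := Nat.exists_eq_add_of_lt hi
  induction k generalizing i with
  | zero =>
    obtain rfl : n = i + 1 := by omega
    exact ⟨ramIdx φ lam (i + 1), (h.natDegree_succ hi).1, (h.natDegree_succ hi).2.1.ge⟩
  | succ k ih =>
    have hi1 : i + 1 < n := by omega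
    obtain ⟨M, hM, hle⟩ := ih hi1 (by omega)
    obtain ⟨V, hV, H, -⟩ := h.exists_augmentable hi1
    refine ⟨M * ramIdx φ lam (i + 1), ?_, ?_⟩
    · rw [hM, (h.natDegree_succ hi).1, mul_assoc]
    set f := φ (n + 1)
    rw [← hV, ← sum_digit H.monic (natDegree_lt_succ_mul H.natDegree_pos f)]
    refine V.map_le_sum fun j _ => ?_
    by_cases h0 : digit (φ (i + 2)) f j = 0
    · rw [h0, mul_zero, V.map_zero]
      exact le_top
    have hjM : j ≤ M := by
      by_contra! hlt
      refine h0 (digit_eq_zero_of_natDegree_lt H.monic ?_)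
      rw [hM]
      exact Nat.mul_lt_mul_of_pos_right hlt H.natDegree_pos
    have hval : val O φ lam (i + 1 + 1) f = H.valuation f := by
      rw [H.coe_valuation, hV]
      rfl
    rw [hval] at hle
    have h1 := hle.trans (H.valuation_le f j)
    have hφ : V (φ (i + 2)) = ((ramIdx φ lam (i + 1) * lam (i + 1) : ℚ) : WithTop ℚ) := by
      rw [hV, (h.natDegree_succ hi).2.1]
    obtain ⟨q, hq⟩ := WithTop.ne_top_iff_exists.1 (H.ne_top _ h0 (H.digit_lt f j))
    have hlt := h.ramIdx_mul_lam_lt hi1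
    rw [V.map_mul, V.map_pow, hφ, ← hq, ← WithTop.coe_nsmul, ← WithTop.coe_add,
      WithTop.coe_le_coe, nsmul_eq_mul]
    rw [← hq, ← WithTop.coe_add, WithTop.coe_le_coe] at h1
    have hjM' : (j : ℚ) ≤ M := by exact_mod_cast hjM
    push_cast
    change (M : ℚ) * lam (i + 2) ≤ q + j * lam (i + 2) at h1
    nlinarith [mul_nonneg (sub_nonneg.2 hjM') (sub_nonneg.2 hlt.le)]

end KeyChain

end Chain

/-! ### Valuations of polynomials at the roots of the last key polynomial. -/

section Root

/-- A Newton polygon bound: if w x < l, the term x^M would strictly dominate and could not cancel.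
-/
theorem le_map_of_sum_eq_zero {Ω : Type*} [Field Ω] (w : AddValuation Ω (WithTop ℚ)) {x : Ω}
    {c : ℕ → Ω} {M : ℕ} {l : ℚ} (hsum : ∑ j ∈ Finset.range M, c j * x ^ j + x ^ M = 0)
    (hc : ∀ j < M, (((M - j) * l : ℚ) : WithTop ℚ) ≤ w (c j)) : (l : WithTop ℚ) ≤ w x := by
  by_contra! hlt
  obtain ⟨m, hm⟩ := WithTop.ne_top_iff_exists.1 hlt.ne_top
  rw [← hm, WithTop.coe_lt_coe] at hlt
  have hM : w (x ^ M) = ((M * m : ℚ) : WithTop ℚ) := by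
    rw [w.map_pow, ← hm, ← WithTop.coe_nsmul, nsmul_eq_mul]
  have h1 : w (x ^ M) < w (∑ j ∈ Finset.range M, c j * x ^ j) := by
    refine w.map_lt_sum (by rw [hM]; exact WithTop.coe_ne_top) fun j hj => ?_
    rw [Finset.mem_range] at hj
    have hj' : (j : ℚ) < M := by exact_mod_cast hj
    rw [hM, w.map_mul, w.map_pow, ← hm, ← WithTop.coe_nsmul, nsmul_eq_mul]
    refine lt_of_lt_of_le ?_ (add_le_add_left (hc j hj) _)
    rw [← WithTop.coe_add, WithTop.coe_lt_coe]
    nlinarith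
  rw [eq_neg_of_add_eq_zero_left hsum, w.map_neg] at h1
  exact lt_irrefl _ h1

variable {O : Type*} [CommRing O] [IsDomain O] [IsDiscreteValuationRing O]
variable {K : Type*} [Field K] [Algebra O K] [IsFractionRing O K]
variable {n : ℕ} {φ : ℕ → K[X]} {lam : ℕ → ℚ} {Ω : Type*} [Field Ω] [Algebra K Ω]

theorem map_root_nonneg (w : AddValuation Ω (WithTop ℚ))
    (hw : ∀ x : K, w (algebraMap K Ω x) = ord O x) {f : K[X]} (hf : f.Monic)
    (hint : f ∈ Polynomial.lifts (algebraMap O K)) {β : Ω} (hβ : aeval β f = 0) : 0 ≤ w β := by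
  obtain ⟨g, hg⟩ := (mem_lifts _).1 hint
  refine le_map_of_sum_eq_zero w (c := fun j => algebraMap K Ω (f.coeff j)) (M := f.natDegree)
    (l := 0) ?_ fun j _ => ?_
  · rw [aeval_eq_sum_range, Finset.sum_range_succ, coeff_natDegree, hf.leadingCoeff, one_smul] at hβ
    simpa [Algebra.smul_def] using hβ
  · rw [hw, mul_zero, ← hg, coeff_map]
    exact ord_algebraMap_nonneg O _

/-- Expanding f(β) = 0 in powers of φ_{i+1}(β), the digits are bounded by `exists_le_val` and the
previous case, so the Newton polygon bound gives w(φ_{i+1}(β)) ≥ λ_{i+1}. A general g is then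
estimated digit by digit. -/
theorem KeyChain.val_le [IsAlgClosed (IsLocalRing.ResidueField O)] (h : KeyChain O n φ lam)
    (w : AddValuation Ω (WithTop ℚ)) (hw : ∀ x : K, w (algebraMap K Ω x) = ord O x) {β : Ω}
    (hβ : aeval β (φ (n + 1)) = 0) : ∀ i ≤ n, ∀ g : K[X], val O φ lam i g ≤ w (aeval β g) := by
  intro i
  induction i with
  | zero =>
    intro _ g
    rw [aeval_eq_sum_range]
    refine w.map_le_sum fun j _ => ?_
    have hβ0 := map_root_nonneg w hw (h.key n le_rfl).monic (h.key n le_rfl).integral hβ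
    rw [Algebra.smul_def, w.map_mul, w.map_pow, hw]
    refine le_trans ?_ (le_add_of_nonneg_right (nsmul_nonneg hβ0 j))
    by_cases h0 : g.coeff j = 0
    · rw [h0, ord_zero]
      exact le_top
    · exact Finset.inf_le (mem_support_iff.2 h0)
  | succ i ih =>
    intro hi g
    obtain ⟨V, hV, H, -⟩ := h.exists_augmentable hi
    obtain ⟨M, hM, hle⟩ := h.exists_le_val hi
    have hval : val O φ lam (i + 1) = H.valuation := by
      rw [H.coe_valuation, hV]
      rfl
    have ih' := ih (by omega)
    rw [← hV] at ih'
    have hphi : (lam (i + 1) : WithTop ℚ) ≤ w (aeval β (φ (i + 1))) := by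
      set f := φ (n + 1) with hf
      refine le_map_of_sum_eq_zero w (c := fun j => aeval β (digit (φ (i + 1)) f j)) (M := M)
        ?_ fun j _ => ?_
      · have hs := sum_digit H.monic (f := f) (n := M + 1) (by
          rw [hM]
          exact Nat.mul_lt_mul_of_pos_right (Nat.lt_succ_self M) H.natDegree_pos)
        rw [Finset.sum_range_succ, digit_of_natDegree_eq H.monic H.natDegree_pos
          (h.key n le_rfl).monic hM, mul_one] at hs
        rw [← hs] at hβ
        rw [← hβ, map_add, map_sum, map_pow]
        congr 1
        refine Finset.sum_congr rfl fun j _ => ?_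
        rw [map_mul, map_pow, mul_comm]
      · refine le_trans ?_ (ih' _)
        rw [hval] at hle
        have h1 := hle.trans (H.valuation_le f j)
        by_cases h0 : digit (φ (i + 1)) f j = 0
        · rw [h0, V.map_zero]
          exact le_top
        obtain ⟨q, hq⟩ := WithTop.ne_top_iff_exists.1 (H.ne_top _ h0 (H.digit_lt f j))
        rw [← hq, ← WithTop.coe_add, WithTop.coe_le_coe] at h1
        rw [← hq, WithTop.coe_le_coe]
        linarith
    conv_rhs => rw [← sum_digit H.monic (natDegree_lt_succ_mul H.natDegree_pos g)]
    rw [map_sum, hval]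
    refine w.map_le_sum fun j _ => ?_
    refine (H.valuation_le g j).trans ?_
    rw [map_mul, map_pow, w.map_mul, w.map_pow, add_comm]
    refine add_le_add ?_ (ih' _)
    rw [← nsmul_eq_mul, WithTop.coe_nsmul]
    exact nsmul_le_nsmul_right hphi j

theorem KeyChain.lam_le [IsAlgClosed (IsLocalRing.ResidueField O)] (h : KeyChain O n φ lam)
    (w : AddValuation Ω (WithTop ℚ)) (hw : ∀ x : K, w (algebraMap K Ω x) = ord O x) {β : Ω}
    (hβ : aeval β (φ (n + 1)) = 0) {i : ℕ} (hi : i < n) :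
    (lam (i + 1) : WithTop ℚ) ≤ w (aeval β (φ (i + 1))) := by
  refine le_trans ?_ (h.val_le w hw hβ (i + 1) hi _)
  obtain ⟨V, hV, H, -⟩ := h.exists_augmentable hi
  have hval : val O φ lam (i + 1) = H.valuation := by
    rw [H.coe_valuation, hV]
    rfl
  have := H.valuation_pow_mul 1 1
  rw [pow_one, mul_one, AddValuation.map_one, zero_add, Nat.cast_one, one_mul] at this
  rw [hval, this]

end Root

end MacLane

namespace MacLane

/-! ### Triangular families and the sum of their rounded values. -/

variable {K : Type*} [Field K] {Ω : Type*} [Field Ω] [Algebra K Ω]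
  {w : AddValuation Ω (WithTop ℚ)} {f : K[X]}

/-- A family `G 0, …, G (d - 1)` of monic polynomials of degrees `0, …, d - 1`, whose values at
all roots of `f` have valuations bounded below by rationals `x m ∈ (1 / d) ℤ` that are distinct
modulo `1`. -/
structure IsTriangular (w : AddValuation Ω (WithTop ℚ)) (f : K[X]) (d : ℕ) (D : ℚ)
    (G : ℕ → K[X]) (x : ℕ → ℚ) : Prop where
  monic : ∀ m < d, (G m).Monic
  natDegree : ∀ m < d, (G m).natDegree = m
  le : ∀ m < d, ∀ β : Ω, aeval β f = 0 → (x m : WithTop ℚ) ≤ w (aeval β (G m))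
  int : ∀ m < d, ∃ k : ℤ, d * x m = k
  inj : ∀ m < d, ∀ m' < d, ∀ k : ℤ, x m - x m' = k → m = m'
  sum : 2 * ∑ m ∈ Finset.range d, x m = D + d - 1

theorem isTriangular_one : IsTriangular w f 1 0 (fun _ => 1) (fun _ => 0) where
  monic _ _ := monic_one
  natDegree m hm := by rw [natDegree_one]; omega
  le _ _ β _ := by simp
  int _ _ := ⟨0, by simp⟩
  inj m hm m' hm' _ _ := by omega
  sum := by simp

theorem sum_range_mul_div_add_mod {d : ℕ} (hd : 0 < d) (r : ℕ) (l : ℚ) (x : ℕ → ℚ) :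
    2 * ∑ m ∈ Finset.range (r * d), (((m / d : ℕ) : ℚ) * l + x (m % d)) =
      r * (2 * ∑ m ∈ Finset.range d, x m) + d * l * r * (r - 1) := by
  induction r with
  | zero => simp
  | succ r ih =>
    rw [Nat.succ_mul, Finset.sum_range_add, mul_add, ih]
    have : ∀ m ∈ Finset.range d,
        ((((r * d + m) / d : ℕ) : ℚ) * l + x ((r * d + m) % d)) = r * l + x m := by
      intro m hm
      rw [Finset.mem_range] at hm
      rw [mul_comm r d, Nat.mul_add_div hd, Nat.div_eq_of_lt hm, add_zero, Nat.mul_add_mod,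
        Nat.mod_eq_of_lt hm]
    rw [Finset.sum_congr rfl this, Finset.sum_add_distrib, Finset.sum_const, Finset.card_range,
      nsmul_eq_mul]
    push_cast
    ring

namespace IsTriangular

variable {d : ℕ} {D : ℚ} {G : ℕ → K[X]} {x : ℕ → ℚ}

/-- Mixed radix: m / d is the exponent of the new φ. If two values agree modulo 1, the denominator
of d l divides the difference of these exponents, which are both smaller than it; hence they
coincide and the old family decides. -/
theorem step (h : IsTriangular w f d D G x) (hd : 0 < d) {φ : K[X]} (hφ : φ.Monic)
    (hdeg : φ.natDegree = d) {l : ℚ}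
    (hl : ∀ β : Ω, aeval β f = 0 → (l : WithTop ℚ) ≤ w (aeval β φ)) :
    IsTriangular w f ((d * l).den * d)
      ((d * l).den * D + ((d * l).den - 1) * ((d * l).den * (d * l) - 1))
      (fun m => φ ^ (m / d) * G (m % d)) (fun m => ((m / d : ℕ) : ℚ) * l + x (m % d)) := by
  set r := (d * l).den with hr
  have hmod : ∀ m, m % d < d := fun m => Nat.mod_lt m hd
  refine ⟨fun m _ => (hφ.pow _).mul (h.monic _ (hmod m)), fun m _ => ?_, fun m _ β hβ => ?_,
    fun m _ => ?_, fun m hm m' hm' k hk => ?_, ?_⟩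
  · rw [(hφ.pow _).natDegree_mul (h.monic _ (hmod m)), natDegree_pow, hdeg,
      h.natDegree _ (hmod m), mul_comm, Nat.div_add_mod]
  · rw [map_mul, map_pow, w.map_mul, w.map_pow, WithTop.coe_add, ← nsmul_eq_mul,
      WithTop.coe_nsmul]
    exact add_le_add (nsmul_le_nsmul_right (hl β hβ) _) (h.le _ (hmod m) β hβ)
  · obtain ⟨k, hk⟩ := h.int _ (hmod m)
    have h1 := Rat.mul_den_eq_num (d * l)
    rw [← hr] at h1
    generalize m / d = q
    refine ⟨q * (d * l).num + r * k, ?_⟩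
    push_cast
    linear_combination q * h1 + r * hk
  · obtain ⟨a, ha⟩ := h.int _ (hmod m)
    obtain ⟨b, hb⟩ := h.int _ (hmod m')
    have h1 : (((m / d : ℕ) : ℚ) - (m' / d : ℕ)) * (d * l) = d * k - a + b := by
      rw [← ha, ← hb, ← hk]
      ring
    have h2 : (((m / d : ℕ) : ℤ) - (m' / d : ℕ)) * (d * l).num = (d * k - a + b) * r := by
      have h3 := Rat.mul_den_eq_num (d * l)
      rw [← hr] at h3
      have : (((m / d : ℕ) : ℚ) - (m' / d : ℕ)) * (d * l).num = (d * k - a + b) * r := by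
        rw [← h3, ← h1]
        ring
      exact_mod_cast this
    have hcop : IsCoprime (r : ℤ) (d * l).num := by
      rw [Int.isCoprime_iff_gcd_eq_one, Int.gcd_comm]
      exact (d * l).reduced
    have hdvd : (r : ℤ) ∣ ((m / d : ℕ) : ℤ) - (m' / d : ℕ) :=
      hcop.dvd_of_dvd_mul_right ⟨d * k - a + b, by rw [h2]; ring⟩
    have hq : m / d < r := Nat.div_lt_of_lt_mul (by rwa [mul_comm])
    have hq' : m' / d < r := Nat.div_lt_of_lt_mul (by rwa [mul_comm])
    have hqq : m / d = m' / d := by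
      generalize m / d = q at hdvd hq
      generalize m' / d = q' at hdvd hq'
      have h0 := Int.eq_zero_of_abs_lt_dvd hdvd (by rw [abs_lt]; omega)
      omega
    have hs := h.inj _ (hmod m) _ (hmod m') k (by rw [← hk, hqq]; ring)
    rw [← Nat.div_add_mod m d, ← Nat.div_add_mod m' d, hqq, hs]
  · rw [sum_range_mul_div_add_mod hd, h.sum]
    push_cast
    ring

/-- The d fractional parts are distinct elements of (1/d)ℤ in [0, 1), so they exhaust k/d for k < d
and sum to (d - 1)/2, the correction built into the field `sum`. -/
theorem two_mul_sum_floor (h : IsTriangular w f d D G x) (hd : 0 < d) :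
    2 * ∑ m ∈ Finset.range d, (⌊x m⌋ : ℚ) = D := by
  have hd' : (0 : ℚ) < d := by exact_mod_cast hd
  have hk : ∀ m, ∃ k : ℕ, m < d → k < d ∧ d * Int.fract (x m) = k := by
    intro m
    by_cases hm : m < d
    · obtain ⟨a, ha⟩ := h.int m hm
      have h1 : d * Int.fract (x m) = ((a - d * ⌊x m⌋ : ℤ) : ℚ) := by
        rw [Int.fract, mul_sub, ha]
        push_cast
        ring
      have h2 : (0 : ℤ) ≤ a - d * ⌊x m⌋ := by
        have : 0 ≤ d * Int.fract (x m) := mul_nonneg hd'.le (Int.fract_nonneg _)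
        rw [h1] at this
        exact_mod_cast this
      have h3 : a - d * ⌊x m⌋ < d := by
        have : d * Int.fract (x m) < d * 1 := mul_lt_mul_of_pos_left (Int.fract_lt_one _) hd'
        rw [h1, mul_one] at this
        exact_mod_cast this
      refine ⟨(a - d * ⌊x m⌋).toNat, fun _ => ⟨by omega, ?_⟩⟩
      rw [h1]
      have := Int.toNat_of_nonneg h2
      exact_mod_cast this.symm
    · exact ⟨0, fun hm' => absurd hm' hm⟩
  choose k hk using hk
  have hinj : Set.InjOn k (Finset.range d : Set ℕ) := by
    intro m hm m' hm' hkk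
    rw [Finset.mem_coe, Finset.mem_range] at hm hm'
    have h1 : Int.fract (x m) = Int.fract (x m') := by
      refine mul_left_cancel₀ hd'.ne' ?_
      rw [(hk m hm).2, (hk m' hm').2, hkk]
    refine h.inj m hm m' hm' (⌊x m⌋ - ⌊x m'⌋) ?_
    rw [Int.fract, Int.fract] at h1
    push_cast
    linear_combination h1
  have himg : (Finset.range d).image k = Finset.range d := by
    refine Finset.eq_of_subset_of_card_le ?_ ?_
    · intro j hj
      obtain ⟨m, hm, rfl⟩ := Finset.mem_image.1 hj
      exact Finset.mem_range.2 (hk m (Finset.mem_range.1 hm)).1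
    · rw [Finset.card_image_of_injOn hinj]
  have hsum : ∑ m ∈ Finset.range d, (k m : ℚ) = ∑ j ∈ Finset.range d, (j : ℚ) := by
    conv_rhs => rw [← himg]
    rw [Finset.sum_image hinj]
  have hgauss : 2 * ∑ j ∈ Finset.range d, (j : ℚ) = d * (d - 1) := by
    clear * -
    induction d with
    | zero => simp
    | succ d ih =>
      rw [Finset.sum_range_succ, mul_add, ih]
      push_cast
      ring
  have hfr : d * ∑ m ∈ Finset.range d, Int.fract (x m) = ∑ m ∈ Finset.range d, (k m : ℚ) := by
    rw [Finset.mul_sum]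
    exact Finset.sum_congr rfl fun m hm => (hk m (Finset.mem_range.1 hm)).2
  have hfl : ∑ m ∈ Finset.range d, (⌊x m⌋ : ℚ) =
      ∑ m ∈ Finset.range d, x m - ∑ m ∈ Finset.range d, Int.fract (x m) := by
    rw [← Finset.sum_sub_distrib]
    exact Finset.sum_congr rfl fun m _ => (Int.self_sub_fract (x m)).symm
  refine mul_left_cancel₀ hd'.ne' ?_
  rw [hfl]
  linear_combination d * h.sum - 2 * hfr - 2 * hsum - hgauss

end IsTriangular

end MacLane

namespace MacLane

/-! ### Discriminants of power bases and triangular bases. -/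

section PowerBasis

variable {K L : Type*} [Field K] [Field L] [Algebra K L]

/-- Both sides are the product of g over the conjugates of the generator. -/
theorem norm_aeval_gen_eq_resultant [FiniteDimensional K L] [Algebra.IsSeparable K L]
    (pb : PowerBasis K L) (g : K[X]) {n : ℕ} (hg : g.natDegree ≤ n) :
    Algebra.norm K (aeval pb.gen g) =
      resultant (minpoly K pb.gen) g (minpoly K pb.gen).natDegree n := by
  classical
  set E := AlgebraicClosure L
  apply (algebraMap K E).injective
  have hmon := minpoly.monic pb.isIntegral_gen
  have hsep : (minpoly K pb.gen).Separable := Algebra.IsSeparable.isSeparable K pb.gen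
  rw [Algebra.norm_eq_prod_embeddings, ← resultant_map_map, ← natDegree_map (algebraMap K E),
    resultant_eq_prod_eval _ _ _ (natDegree_map_le.trans hg) (IsAlgClosed.splits _),
    (hmon.map _).leadingCoeff, one_pow, one_mul]
  rw [Fintype.prod_equiv pb.liftEquiv' (fun σ : L →ₐ[K] E => σ (aeval pb.gen g))
    (fun x => (g.map (algebraMap K E)).eval (x : E))]
  · rw [Finset.prod_mem_multiset _ _ (fun x => (g.map (algebraMap K E)).eval x) (fun _ => rfl),
      Finset.prod_eq_multiset_prod, Multiset.toFinset_val, Multiset.dedup_eq_self.mpr]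
    exact nodup_roots (.map hsep)
  · intro σ
    rw [PowerBasis.liftEquiv'_apply_coe, eval_map, ← aeval_def, aeval_algHom_apply]

/-- The sign relating the basis discriminant to the norm of f' is the one relating the resultant to
the polynomial discriminant, so the two cancel. -/
theorem discr_basis_eq_discr_minpoly [FiniteDimensional K L] [Algebra.IsSeparable K L]
    (pb : PowerBasis K L) : Algebra.discr K pb.basis = (minpoly K pb.gen).discr := by
  have hpos : 0 < (minpoly K pb.gen).degree := minpoly.degree_pos pb.isIntegral_gen
  rw [Algebra.discr_powerBasis_eq_norm, norm_aeval_gen_eq_resultant pb _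
    (natDegree_derivative_le _), resultant_deriv hpos,
    (minpoly.monic pb.isIntegral_gen).leadingCoeff, mul_one, ← mul_assoc, pb.finrank,
    pb.natDegree_minpoly, ← mul_pow]
  simp

theorem repr_aeval_gen (pb : PowerBasis K L) {g : K[X]} (hg : g.natDegree < pb.dim)
    (j : Fin pb.dim) : pb.basis.repr (aeval pb.gen g) j = g.coeff j := by
  have : aeval pb.gen g = ∑ i : Fin pb.dim, g.coeff i • pb.basis i := by
    rw [aeval_eq_sum_range' hg, ← Fin.sum_univ_eq_sum_range fun i => g.coeff i • pb.gen ^ i]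
    simp
  rw [this, pb.basis.repr_sum_self]

theorem discr_triangular [FiniteDimensional K L] [Algebra.IsSeparable K L] (pb : PowerBasis K L)
    {G : ℕ → K[X]} (hG : ∀ m < pb.dim, (G m).Monic) (hd : ∀ m < pb.dim, (G m).natDegree = m)
    (c : ℕ → K) :
    Algebra.discr K (fun m : Fin pb.dim => c m • aeval pb.gen (G m)) =
      (∏ m ∈ Finset.range pb.dim, c m) ^ 2 * (minpoly K pb.gen).discr := by
  have h1 := Module.Basis.toMatrix_map_vecMul pb.basis
    (fun m : Fin pb.dim => c m • aeval pb.gen (G m))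
  rw [← h1, Algebra.discr_of_matrix_vecMul, discr_basis_eq_discr_minpoly]
  congr 2
  have hent : ∀ i j : Fin pb.dim,
      pb.basis.toMatrix (fun m : Fin pb.dim => c m • aeval pb.gen (G m)) i j =
        c j * (G j).coeff i := by
    intro i j
    rw [Module.Basis.toMatrix_apply, map_smul, Finsupp.smul_apply, smul_eq_mul,
      repr_aeval_gen pb (by rw [hd j j.2]; exact j.2)]
  rw [Matrix.det_of_isUpperTriangular]
  · rw [← Fin.prod_univ_eq_prod_range]
    refine Finset.prod_congr rfl fun i _ => ?_
    have h2 := (hG i i.2).coeff_natDegree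
    rw [hd i i.2] at h2
    rw [hent, h2, mul_one]
  · intro i j hij
    rw [hent, coeff_eq_zero_of_natDegree_lt, mul_zero]
    rw [hd j j.2]
    exact hij

end PowerBasis

/-! ### Integrality from the valuations of conjugates. -/

section Integrality

variable {O : Type*} [CommRing O] [IsDomain O] [IsDiscreteValuationRing O]
variable {K : Type*} [Field K] [Algebra O K] [IsFractionRing O K]
variable {Ω : Type*} [Field Ω] [Algebra K Ω]

theorem coeff_prod_X_sub_C_nonneg (w : AddValuation Ω (WithTop ℚ)) (s : Multiset Ω)
    (hs : ∀ y ∈ s, 0 ≤ w y) (i : ℕ) : 0 ≤ w ((s.map fun y => X - C y).prod.coeff i) := by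
  induction s using Multiset.induction_on generalizing i with
  | empty =>
    rw [Multiset.map_zero, Multiset.prod_zero, coeff_one]
    split_ifs <;> simp
  | cons a s ih =>
    have ih' := ih fun y hy => hs y (by simp [hy])
    have ha := hs a (by simp)
    rw [Multiset.map_cons, Multiset.prod_cons, sub_mul, coeff_sub, coeff_C_mul]
    refine w.map_le_sub ?_ ?_
    · cases i with
      | zero => simp
      | succ i => rw [coeff_X_mul]; exact ih' i
    · rw [w.map_mul]
      exact add_nonneg ha (ih' i)

variable [Algebra.IsSeparable K Ω] [IsSepClosed Ω] [Algebra O Ω] [IsScalarTower O K Ω]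

/-- Every conjugate of g(α) is g(β) for a conjugate β of α, so the minimal polynomial of g(α) is a
product of X - y with w y ≥ 0 and has coefficients in O. -/
theorem isIntegral_aeval (w : AddValuation Ω (WithTop ℚ))
    (hw : ∀ x : K, w (algebraMap K Ω x) = ord O x) (α : Ω) (g : K[X])
    (hg : ∀ β : Ω, aeval β (minpoly K α) = 0 → 0 ≤ w (aeval β g)) :
    IsIntegral O (aeval α g) := by
  have : IsSepClosure K Ω := ⟨inferInstance, inferInstance⟩
  have : IsGalois K Ω := inferInstance
  set x := aeval α g with hx
  have hxint : IsIntegral K x := Algebra.IsSeparable.isIntegral K x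
  set p := minpoly K x with hp
  have hsep : p.Separable := Algebra.IsSeparable.isSeparable K x
  have hsplit : (p.map (algebraMap K Ω)).Splits :=
    IsSepClosed.splits_codomain p hsep
  have hroots : ∀ y ∈ (p.map (algebraMap K Ω)).roots, 0 ≤ w y := by
    intro y hy
    have hy' : aeval y p = 0 := by
      have := (mem_roots'.1 hy).2
      rwa [IsRoot.def, eval_map, ← aeval_def] at this
    obtain ⟨σ, hσ⟩ := minpoly.exists_algEquiv_of_root' hxint.isAlgebraic hy'
    have hσg : ∀ h : K[X], σ (aeval α h) = aeval (σ α) h := fun h =>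
      (aeval_algHom_apply (σ : Ω →ₐ[K] Ω) α h).symm
    rw [← hσ, hx, hσg]
    apply hg
    rw [← hσg, minpoly.aeval, map_zero]
  have hmon : p.Monic := minpoly.monic hxint
  have hlift : p ∈ lifts (algebraMap O K) := by
    rw [lifts_iff_coeff_lifts]
    intro i
    rw [Set.mem_range, ← ord_nonneg_iff, ← hw, ← coeff_map]
    have h1 := hsplit.eq_prod_roots_of_monic (hmon.map _)
    rw [h1]
    exact coeff_prod_X_sub_C_nonneg w _ hroots i
  obtain ⟨q, hq, -, hqm⟩ := lifts_and_natDegree_eq_and_monic hlift hmon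
  refine ⟨q, hqm, ?_⟩
  have h0 : aeval x (q.map (algebraMap O K)) = 0 := by rw [hq]; exact minpoly.aeval K x
  rwa [aeval_map_algebraMap] at h0

end Integrality

/-! ### Bounding the discriminant bonus by integral elements. -/

section Discriminant

variable (O : Type*) [CommRing O] [IsDomain O] [IsDiscreteValuationRing O]
variable (K : Type*) [Field K] [Algebra O K] [IsFractionRing O K]

theorem discr_comp_equiv {A B ι ι' : Type*} [CommRing A] [CommRing B] [Algebra A B] [Fintype ι]
    [Fintype ι'] [DecidableEq ι] [DecidableEq ι'] (b : ι → B) (e : ι' ≃ ι) :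
    Algebra.discr A (b ∘ e) = Algebra.discr A b := by
  rw [Algebra.discr_def, Algebra.discr_def]
  exact Matrix.det_submatrix_equiv_self e (Algebra.traceMatrix A b)

theorem exists_discr_eq_sq_mul_fieldDiscr (L : Type*) [Field L] [Algebra K L] [Algebra O L]
    [IsScalarTower O K L] [FiniteDimensional K L] [Algebra.IsSeparable K L] {N : ℕ}
    (hN : Module.finrank K L = N) (b : Fin N → L) (hb : ∀ i, IsIntegral O (b i)) :
    ∃ a : O, Algebra.discr K b = algebraMap O K a ^ 2 * fieldDiscr O K L := by
  classical
  have : Module.Finite O (integralClosure O L) :=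
    IsIntegralClosure.finite O K L (integralClosure O L)
  have : Module.IsTorsionFree O K := inferInstance
  have : Module.IsTorsionFree O L := Module.IsTorsionFree.trans_faithfulSMul O K L
  have : Module.Free O (integralClosure O L) :=
    IsIntegralClosure.module_free O K L (integralClosure O L)
  let B := Module.Free.chooseBasis O (integralClosure O L)
  have hcard : Fintype.card (Module.Free.ChooseBasisIndex O (integralClosure O L)) =
      Fintype.card (Fin N) := by
    rw [← Module.finrank_eq_card_chooseBasisIndex, IsIntegralClosure.rank O K L, hN,
      Fintype.card_fin]
  let e := Fintype.equivOfCardEq hcard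
  let b' : Module.Free.ChooseBasisIndex O (integralClosure O L) → integralClosure O L :=
    fun i => ⟨b (e i), hb (e i)⟩
  let P := B.toMatrix b'
  -- The scalar is the determinant of the matrix expressing the elements in an integral basis.
  refine ⟨P.det, ?_⟩
  have h1 : Matrix.vecMul (fun i => ((B i : integralClosure O L) : L))
      ((P.map (algebraMap O K)).map (algebraMap K L)) = b ∘ e := by
    funext i
    have h2 := congrFun (Module.Basis.toMatrix_map_vecMul B b') i
    have h3 := congrArg (fun z : integralClosure O L => (z : L)) h2
    simp only [Matrix.vecMul, dotProduct, Matrix.map_apply] at h3 ⊢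
    simpa [P, b', ← IsScalarTower.algebraMap_apply] using h3
  rw [← discr_comp_equiv b e, ← h1, Algebra.discr_of_matrix_vecMul, ← RingHom.mapMatrix_apply,
    ← RingHom.map_det]
  rfl

variable {O K} {Ω : Type*} [Field Ω] [Algebra K Ω] [Algebra.IsSeparable K Ω] [IsSepClosed Ω]
  [Algebra O Ω] [IsScalarTower O K Ω]

theorem ordInt_prod {ι : Type*} (s : Finset ι) (c : ι → K) (hc : ∀ i ∈ s, c i ≠ 0) :
    ordInt O (∏ i ∈ s, c i) = ∑ i ∈ s, ordInt O (c i) := by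
  classical
  induction s using Finset.induction_on with
  | empty => simp [ordInt_one]
  | insert a s ha ih =>
    rw [Finset.prod_insert ha, Finset.sum_insert ha, ordInt_mul O (hc a (by simp)),
      ih fun i hi => hc i (by simp [hi])]
    exact Finset.prod_ne_zero_iff.2 fun i hi => hc i (by simp [hi])

theorem le_discBonus (w : AddValuation Ω (WithTop ℚ))
    (hw : ∀ x : K, w (algebraMap K Ω x) = ord O x) (α : Ω) {G : ℕ → K[X]} {k : ℕ → ℤ}
    (hG : ∀ m < (minpoly K α).natDegree, (G m).Monic)
    (hd : ∀ m < (minpoly K α).natDegree, (G m).natDegree = m)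
    (hk : ∀ m < (minpoly K α).natDegree, ∀ β : Ω, aeval β (minpoly K α) = 0 →
      ((k m : ℚ) : WithTop ℚ) ≤ w (aeval β (G m))) :
    2 * ∑ m ∈ Finset.range (minpoly K α).natDegree, k m ≤ discBonus O K α := by
  have hα : IsIntegral K α := Algebra.IsSeparable.isIntegral K α
  have : FiniteDimensional K K⟮α⟯ := adjoin.finiteDimensional hα
  have : Algebra.IsSeparable K K⟮α⟯ := inferInstance
  let pb : PowerBasis K K⟮α⟯ := adjoin.powerBasis hα
  have hdim : pb.dim = (minpoly K α).natDegree := adjoin.powerBasis_dim hα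
  have hgen : minpoly K pb.gen = minpoly K α := by
    rw [adjoin.powerBasis_gen, minpoly_gen]
  rw [← hdim] at hG hd hk ⊢
  obtain ⟨p, hp0, hp1⟩ := exists_ordInt_eq_one O K
  -- Dividing G_m(α) by p^{k m} keeps it integral and lowers the valuation of the discriminant by 2
  -- Σ k m in total.
  have hdisc := discr_triangular pb hG hd fun m => p ^ (-k m)
  have hint : ∀ i : Fin pb.dim, IsIntegral O (p ^ (-k i) • aeval pb.gen (G i)) := by
    intro i
    have hinj : Function.Injective ((K⟮α⟯.val).restrictScalars O) := K⟮α⟯.val.injective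
    rw [← isIntegral_algHom_iff _ hinj]
    have e1 : ((K⟮α⟯.val).restrictScalars O) (p ^ (-k i) • aeval pb.gen (G i)) =
        aeval α (C (p ^ (-k i)) * G i) := by
      rw [map_mul, aeval_C, ← Algebra.smul_def, AlgHom.restrictScalars_apply, map_smul,
        ← aeval_algHom_apply]
      congr 3
    rw [e1]
    refine isIntegral_aeval w hw α _ fun β hβ => ?_
    have h2 := hk i i.2 β hβ
    rw [map_mul, aeval_C, w.map_mul, hw, ord_of_ne_zero O (zpow_ne_zero _ hp0), ordInt_zpow, hp1]
    refine le_trans ?_ (add_le_add_right h2 _)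
    rw [← WithTop.coe_add]
    simp
  obtain ⟨a, ha⟩ := exists_discr_eq_sq_mul_fieldDiscr O K K⟮α⟯ pb.finrank _ hint
  rw [hdisc, hgen] at ha
  have hne : (minpoly K α).discr ≠ 0 := by
    rw [← hgen, ← discr_basis_eq_discr_minpoly]
    exact Algebra.discr_not_zero_of_basis K pb.basis
  have hprod : ∏ m ∈ Finset.range pb.dim, p ^ (-k m) ≠ 0 :=
    Finset.prod_ne_zero_iff.2 fun m _ => zpow_ne_zero _ hp0
  have hrhs : algebraMap O K a ^ 2 * fieldDiscr O K K⟮α⟯ ≠ 0 := by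
    rw [← ha]
    exact mul_ne_zero (pow_ne_zero _ hprod) hne
  have ha0 : algebraMap O K a ≠ 0 := fun h => hrhs (by rw [h]; simp)
  have hf0 : fieldDiscr O K K⟮α⟯ ≠ 0 := right_ne_zero_of_mul hrhs
  have hord := congrArg (ordInt O) ha
  rw [ordInt_mul O (pow_ne_zero _ hprod) hne, ordInt_mul O (pow_ne_zero _ ha0) hf0, pow_two,
    pow_two, ordInt_mul O hprod hprod, ordInt_mul O ha0 ha0,
    ordInt_prod _ _ fun m _ => zpow_ne_zero _ hp0] at hord
  have hsum : ∑ m ∈ Finset.range pb.dim, ordInt O (p ^ (-k m)) =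
      -∑ m ∈ Finset.range pb.dim, k m := by
    rw [← Finset.sum_neg_distrib]
    exact Finset.sum_congr rfl fun m _ => by rw [ordInt_zpow, hp1, mul_one]
  have hapos : 0 ≤ ordInt O (algebraMap O K a) := by
    have := ord_algebraMap_nonneg O (K := K) a
    rw [ord_of_ne_zero O ha0] at this
    exact_mod_cast this
  have hdb : discBonus O K α = ordInt O (minpoly K α).discr - ordInt O (fieldDiscr O K K⟮α⟯) := rfl
  rw [hdb]
  rw [hsum] at hord
  linarith

end Discriminant

end MacLane

namespace MacLane

/-! ### A criterion for Eisenstein polynomials. -/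

section GaussBounds

variable {O : Type*} [CommRing O] [IsDomain O] [IsDiscreteValuationRing O]
variable {K : Type*} [Field K] [Algebra O K] [IsFractionRing O K]

theorem gauss_le_ord_coeff (f : K[X]) (i : ℕ) : gauss O f ≤ ord O (f.coeff i) := by
  by_cases h : f.coeff i = 0
  · rw [h, ord_zero]
    exact le_top
  · exact Finset.inf_le (mem_support_iff.2 h)

theorem gauss_map_nonneg (g : O[X]) : 0 ≤ gauss O (g.map (algebraMap O K)) := by
  rw [gauss, Finset.le_inf_iff]
  intro i _
  rw [coeff_map]
  exact ord_algebraMap_nonneg O _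

variable (O) in
theorem two_le_ord_of_mem_sq {x : O} (hx : x ∈ IsLocalRing.maximalIdeal O ^ 2) :
    2 ≤ ord O (algebraMap O K x) := by
  rw [pow_two] at hx
  have hone : ∀ a ∈ IsLocalRing.maximalIdeal O, 1 ≤ ord O (algebraMap O K a) := by
    intro a ha
    have h := (ord_algebraMap_pos_iff O (K := K)).2 ha
    by_cases h0 : algebraMap O K a = 0
    · rw [h0, ord_zero]
      exact le_top
    rw [ord_of_ne_zero O h0] at h ⊢
    have h1 : 0 < ordInt O (algebraMap O K a) := by exact_mod_cast h
    have h2 : 1 ≤ ordInt O (algebraMap O K a) := h1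
    exact_mod_cast h2
  refine Submodule.mul_induction_on hx (fun a ha b hb => ?_) (fun a b ha hb => ?_)
  · rw [map_mul, ord_mul, ← one_add_one_eq_two]
    exact add_le_add (hone a ha) (hone b hb)
  · rw [map_add]
    exact (ordVal O).map_le_add ha hb

/-- As c and the non-leading coefficients lie in the maximal ideal and the degree is at least 2,
f(c) and f(0) agree modulo its square. So f(0) has valuation 1 along with f(c). -/
theorem isEisenstein_of_ord {f : K[X]} (hf : f.Monic) (hint : f ∈ lifts (algebraMap O K))
    (hdeg : 2 ≤ f.natDegree) (hcoeff : ∀ i < f.natDegree, 0 < ord O (f.coeff i)) {c : K}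
    (hc : 0 < ord O c) (heval : ord O (f.eval c) = 1) : IsEisenstein O f := by
  obtain ⟨g, hg, hgd, hgm⟩ := lifts_and_natDegree_eq_and_monic hint hf
  obtain ⟨c₀, rfl⟩ := (ord_nonneg_iff O).1 hc.le
  rw [ord_algebraMap_pos_iff] at hc
  have hmem : ∀ i < f.natDegree, g.coeff i ∈ IsLocalRing.maximalIdeal O := by
    intro i hi
    rw [← ord_algebraMap_pos_iff O (K := K), ← coeff_map, hg]
    exact hcoeff i hi
  refine ⟨g, hg, hgm, ⟨?_, fun {i} hi => hmem i (hgd ▸ hi), fun h0 => ?_⟩⟩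
  · rw [hgm.leadingCoeff]
    exact (Ideal.ne_top_iff_one _).1 (IsLocalRing.maximalIdeal.isMaximal O).ne_top
  · have h1 : g.divX.eval c₀ ∈ IsLocalRing.maximalIdeal O := by
      have e1 : g.divX.eval c₀ = g.divX.divX.eval c₀ * c₀ + g.coeff 1 := by
        conv_lhs => rw [← divX_mul_X_add g.divX]
        simp [coeff_divX]
      rw [e1]
      exact Ideal.add_mem _ (Ideal.mul_mem_left _ _ hc) (hmem 1 (by omega))
    have h2 : g.eval c₀ ∈ IsLocalRing.maximalIdeal O ^ 2 := by
      have e2 : g.eval c₀ = g.divX.eval c₀ * c₀ + g.coeff 0 := by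
        conv_lhs => rw [← divX_mul_X_add g]
        simp
      rw [e2]
      refine Ideal.add_mem _ ?_ h0
      rw [pow_two]
      exact Ideal.mul_mem_mul h1 hc
    have h3 := two_le_ord_of_mem_sq O (K := K) h2
    rw [← eval₂_at_apply, ← eval_map, hg, heval] at h3
    have h4 : ((2 : ℚ) : WithTop ℚ) ≤ ((1 : ℚ) : WithTop ℚ) := h3
    rw [WithTop.coe_le_coe] at h4
    norm_num at h4

end GaussBounds

/-! ### The bonus of a chain and the case of equality. -/

section Bound

variable {O : Type*} [CommRing O] [IsDomain O] [IsDiscreteValuationRing O]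
variable {K : Type*} [Field K] [Algebra O K] [IsFractionRing O K]
variable {n : ℕ} {φ : ℕ → K[X]} {lam : ℕ → ℚ} {Ω : Type*} [Field Ω] [Algebra K Ω]

/-- The discriminant bonus of a root of `φ (i + 1)`, expressed by the invariants of the chain. -/
noncomputable def chainBonus (φ : ℕ → K[X]) (lam : ℕ → ℚ) : ℕ → ℚ
  | 0 => 0
  | i + 1 => ramIdx φ lam (i + 1) * chainBonus φ lam i +
    (ramIdx φ lam (i + 1) - 1) *
      (ramIdx φ lam (i + 1) * ((φ (i + 1)).natDegree * lam (i + 1)) - 1)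

variable [IsAlgClosed (IsLocalRing.ResidueField O)]

namespace KeyChain

theorem exists_isTriangular (h : KeyChain O n φ lam) (w : AddValuation Ω (WithTop ℚ))
    (hw : ∀ x : K, w (algebraMap K Ω x) = ord O x) : ∀ i ≤ n, ∃ G x,
    IsTriangular w (φ (n + 1)) (φ (i + 1)).natDegree (chainBonus φ lam i) G x := by
  intro i
  induction i with
  | zero =>
    intro _
    rw [zero_add, h.natDegree_one]
    exact ⟨_, _, isTriangular_one⟩
  | succ i ih =>
    intro hi
    obtain ⟨G, x, hG⟩ := ih (by omega)
    have := hG.step (h.natDegree_pos (by omega)) (h.key i (by omega)).monic rfl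
      fun β hβ => h.lam_le w hw hβ hi
    rw [(h.natDegree_succ hi).1]
    exact ⟨_, _, this⟩

theorem chainBonus_le [Algebra.IsSeparable K Ω] [IsSepClosed Ω] [Algebra O Ω]
    [IsScalarTower O K Ω] (h : KeyChain O n φ lam) (w : AddValuation Ω (WithTop ℚ))
    (hw : ∀ x : K, w (algebraMap K Ω x) = ord O x) {α : Ω} (hα : φ (n + 1) = minpoly K α) :
    chainBonus φ lam n ≤ discBonus O K α := by
  obtain ⟨G, x, hG⟩ := h.exists_isTriangular w hw n le_rfl
  have hpos := h.natDegree_pos le_rfl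
  rw [← hG.two_mul_sum_floor hpos]
  rw [hα] at hG ⊢
  have := le_discBonus w hw α (k := fun m => ⌊x m⌋) hG.monic hG.natDegree fun m hm β hβ =>
    (WithTop.coe_le_coe.2 (Int.floor_le (x m))).trans (hG.le m hm β hβ)
  exact_mod_cast this

theorem one_le_ramIdx_mul (h : KeyChain O n φ lam) {i : ℕ} (hi : i < n) :
    1 ≤ ramIdx φ lam (i + 1) * ((φ (i + 1)).natDegree * lam (i + 1)) := by
  have hd : (0 : ℚ) < (φ (i + 1)).natDegree := by exact_mod_cast h.natDegree_pos hi.le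
  have hpos : 0 < (φ (i + 1)).natDegree * lam (i + 1) := mul_pos hd (h.lam_pos hi)
  -- Denominator times the rational is its numerator, a positive integer.
  rw [mul_comm, ramIdx, Rat.mul_den_eq_num]
  have := Rat.num_pos.2 hpos
  exact_mod_cast this

theorem one_lt_lam (h : KeyChain O n φ lam) {i : ℕ} (hi : i + 1 < n) : 1 < lam (i + 2) := by
  induction i with
  | zero =>
    have h1 := h.one_le_ramIdx_mul (i := 0) (by omega)
    rw [zero_add, h.natDegree_one, Nat.cast_one, one_mul] at h1
    exact h1.trans_lt (h.ramIdx_mul_lam_lt hi)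
  | succ i ih =>
    have h1 := ih (by omega)
    have h2 : (2 : ℚ) ≤ ramIdx φ lam (i + 1 + 1) := by
      exact_mod_cast h.two_le_ramIdx (i := i + 1) (by omega)
    refine lt_trans ?_ (h.ramIdx_mul_lam_lt hi)
    change 1 < lam (i + 1 + 1) at h1
    nlinarith

theorem chainBonus_nonneg (h : KeyChain O n φ lam) : ∀ i ≤ n, 0 ≤ chainBonus φ lam i := by
  intro i
  induction i with
  | zero => exact fun _ => le_rfl
  | succ i ih =>
    intro hi
    have h1 := ih (by omega)
    have h2 : (2 : ℚ) ≤ ramIdx φ lam (i + 1) := by exact_mod_cast h.two_le_ramIdx hi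
    have h3 := h.one_le_ramIdx_mul hi
    rw [chainBonus]
    exact add_nonneg (mul_nonneg (by linarith) h1) (mul_nonneg (by linarith) (by linarith))

/-- In the case of equality this rules out n > 2. -/
theorem chainBonus_pos (h : KeyChain O n φ lam) {i : ℕ} (hi : i + 1 < n) :
    0 < chainBonus φ lam (i + 2) := by
  have h1 := h.chainBonus_nonneg (i + 1) hi.le
  have h2 : (2 : ℚ) ≤ ramIdx φ lam (i + 2) := by exact_mod_cast h.two_le_ramIdx hi
  have h3 := h.one_lt_lam hi
  have h4 : (1 : ℚ) ≤ (φ (i + 2)).natDegree := by exact_mod_cast h.natDegree_pos hi.le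
  have h5 : 1 < (φ (i + 2)).natDegree * lam (i + 2) := by nlinarith
  have h6 : 1 < ramIdx φ lam (i + 2) * ((φ (i + 2)).natDegree * lam (i + 2)) := by nlinarith
  rw [chainBonus]
  exact add_pos_of_nonneg_of_pos (mul_nonneg (by linarith) h1)
    (mul_pos (by linarith) (by linarith))

/-- Here φ_1 = X - c, and c has positive valuation because α and α - c do. In the φ_1-expansion of
φ_2, of value r λ_1 = 1, the digits of index j < r have value at least 1 - j λ_1 > 0, so φ_2 reduces
to X^r. The digit of index 0 is φ_2(c), of valuation exactly 1. -/
theorem isEisenstein (h : KeyChain O n φ lam) (hn : 0 < n) (w : AddValuation Ω (WithTop ℚ))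
    (hw : ∀ x : K, w (algebraMap K Ω x) = ord O x) {α : Ω} (hα : aeval α (φ (n + 1)) = 0)
    (hpos : 0 < w α) (hlam : ramIdx φ lam 1 * lam 1 = 1) : IsEisenstein O (φ 2) := by
  obtain ⟨V, hV, H, S⟩ := h.exists_augmentable hn
  obtain ⟨hdeg, hval, hmod⟩ := h.natDegree_succ hn
  have hr := h.two_le_ramIdx hn
  simp only [zero_add] at H S hdeg hval hmod hr
  rw [h.natDegree_one, mul_one] at hdeg
  rw [hlam] at hval hmod
  set r := ramIdx φ lam 1
  have hφ₂ := h.key 1 hn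
  have hl0 : 0 < lam 1 := h.lam_pos hn
  set c := -(φ 1).coeff 0 with hcdef
  have hφ₁ : φ 1 = X - C c := by
    rw [hcdef, C_neg, sub_neg_eq_add]
    conv_lhs => rw [eq_X_add_C_of_natDegree_le_one h.natDegree_one.le]
    have := H.monic.coeff_natDegree
    rw [h.natDegree_one] at this
    rw [this, C_1, one_mul]
  have hc : 0 < ord O c := by
    have h1 : ((lam 1 : ℚ) : WithTop ℚ) ≤ w (aeval α (φ 1)) := h.lam_le w hw hα hn
    have h2 : 0 < w (aeval α (φ 1)) := lt_of_lt_of_le (by exact_mod_cast hl0) h1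
    have h3 : algebraMap K Ω c = α + -aeval α (φ 1) := by
      rw [hφ₁]
      simp
    rw [← hw, h3]
    exact w.map_lt_add hpos (by rwa [w.map_neg])
  have hVg : ∀ p, V p = gauss O p := fun p => by rw [hV]; rfl
  have hVX : 0 ≤ V X := by
    have := gauss_map_nonneg (O := O) (K := K) X
    rwa [Polynomial.map_X, ← hVg] at this
  have hVφ : 0 ≤ V (φ 1) := by
    rw [hφ₁]
    exact V.map_le_sub hVX (by rw [S.map_C]; exact hc.le)
  have hsub : 0 < V (φ 1 ^ r - X ^ r) := by
    rw [← (Commute.all (φ 1) X).mul_geom_sum₂, V.map_mul]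
    have e1 : φ 1 - X = -C c := by rw [hφ₁]; ring
    rw [e1, V.map_neg, S.map_C]
    refine lt_of_lt_of_le hc (le_add_of_nonneg_right (V.map_le_sum fun i _ => ?_))
    rw [V.map_mul, V.map_pow, V.map_pow]
    exact add_nonneg (nsmul_nonneg hVφ _) (nsmul_nonneg hVX _)
  have hdiff : 0 < V (φ 2 - X ^ r) := by
    have hs := sum_digit H.monic (f := φ 2) (n := r + 1) (by
      rw [h.natDegree_one, hdeg]
      omega)
    rw [Finset.sum_range_succ, digit_of_natDegree_eq H.monic H.natDegree_pos hφ₂.monic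
      (by rw [h.natDegree_one, mul_one]; exact hdeg), mul_one] at hs
    have e1 : φ 2 - X ^ r =
        ∑ j ∈ Finset.range r, φ 1 ^ j * digit (φ 1) (φ 2) j + (φ 1 ^ r - X ^ r) := by
      linear_combination -hs
    rw [e1]
    refine V.map_lt_add (V.map_lt_sum WithTop.zero_ne_top fun j hj => ?_) hsub
    rw [Finset.mem_range] at hj
    rw [V.map_mul, V.map_pow]
    refine lt_of_lt_of_le ?_ (le_add_of_nonneg_left (nsmul_nonneg hVφ _))
    have h1 := H.valuation_le (φ 2) j
    have h2 : H.valuation (φ 2) = ((1 : ℚ) : WithTop ℚ) := by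
      rw [← hval, H.coe_valuation, hV]
      rfl
    rw [h2] at h1
    by_contra! hle
    have h3 := h1.trans (add_le_add_left hle _)
    rw [zero_add, WithTop.coe_le_coe, ← hlam] at h3
    have h4 := le_of_mul_le_mul_right h3 hl0
    have h5 : r ≤ j := by exact_mod_cast h4
    omega
  refine isEisenstein_of_ord hφ₂.monic hφ₂.integral (by omega) (fun i hi => ?_) hc ?_
  · have h1 := hdiff.trans_le ((hVg _).le.trans (gauss_le_ord_coeff (O := O) _ i))
    rw [coeff_sub, coeff_X_pow, if_neg (by omega), sub_zero] at h1
    exact h1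
  · rw [hφ₁, modByMonic_X_sub_C_eq_C_eval, ← hV, S.map_C] at hmod
    exact hmod

end KeyChain

end Bound

/-- The floor may be replaced by x. The inequality already holds at r = 3, x = 2, where it reads 8 <
10, and the hints expand the difference around that point. -/
theorem bonus_lt_of_three_le {r : ℕ} (hr : 3 ≤ r) {x : ℚ} (hx : 2 < x) :
    2 * ((⌊x⌋ : ℚ) + r - 1) < (r - 1) * (r * x - 1) := by
  have hr' : (3 : ℚ) ≤ r := by exact_mod_cast hr
  have hfl := Int.floor_le x
  nlinarith [mul_nonneg (sub_nonneg.2 hr') (sub_nonneg.2 hx.le),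
    mul_nonneg (mul_nonneg (sub_nonneg.2 hr') (sub_nonneg.2 hr')) (sub_nonneg.2 hx.le),
    mul_nonneg (sub_nonneg.2 hr') (sub_nonneg.2 hr')]

end MacLane

theorem proposition7
    (O : Type*) [CommRing O] [IsDomain O] [IsDiscreteValuationRing O] [HenselianLocalRing O]
    [IsAlgClosed (IsLocalRing.ResidueField O)]
    (hchar : ringChar (IsLocalRing.ResidueField O) ≠ 2)
    (K : Type*) [Field K] [Algebra O K] [IsFractionRing O K]
    (Ksep : Type*) [Field Ksep] [Algebra K Ksep] [Algebra.IsSeparable K Ksep] [IsSepClosed Ksep]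
    [Algebra O Ksep] [IsScalarTower O K Ksep]
    -- `w` is the extension of `ν_K` to the separable closure
    (w : AddValuation Ksep (WithTop ℚ))
    (hw : ∀ x : K, w (algebraMap K Ksep x) = MacLane.ord O x)
    (α : Ksep) (hα : 0 < w α)
    (n : ℕ) (hn : 2 ≤ n) (φ : ℕ → K[X]) (lam : ℕ → ℚ)
    (hv : MacLane.IsMacLane O n φ lam)
    (hf : MacLane.IsProperKeyPoly O n φ lam (minpoly K α))
    (e : ℚ) (he : e = ((minpoly K α).natDegree : ℚ) / ((φ n).natDegree : ℚ)) :
    2 ≤ e ∧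
    MacLane.bonusBound e ((φ n).natDegree * lam n) ≤ (MacLane.discBonus O K α : ℚ) ∧
    ((MacLane.discBonus O K α : ℚ) = MacLane.bonusBound e ((φ n).natDegree * lam n) →
      e = 2 ∧ n = 2 ∧ MacLane.IsEisenstein O (φ 2)) := by
  have hc := hv.keyChain (by omega) hf
  set ψ := Function.update φ (n + 1) (minpoly K α) with hψ
  have hψlast : ψ (n + 1) = minpoly K α := Function.update_self ..
  have hψn : ψ n = φ n := Function.update_of_ne (by omega) _ _
  have hψ2 : ψ 2 = φ 2 := Function.update_of_ne (by omega) _ _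
  obtain ⟨p, rfl⟩ : ∃ p, n = p + 2 := ⟨n - 2, by omega⟩
  have hdb := hc.chainBonus_le w hw hψlast
  have hdeg := (hc.natDegree_succ (i := p + 1) (by omega)).1
  have hr := hc.two_le_ramIdx (i := p + 1) (by omega)
  have hdpos := hc.natDegree_pos (i := p + 1) (by omega)
  have hlam := hc.one_lt_lam (i := p) (by omega)
  have hd2 : 2 ≤ (ψ (p + 2)).natDegree := by
    have h1 := hc.natDegree_lt p (by omega)
    have h2 := hc.natDegree_pos (i := p) (by omega)
    omega
  have hb := hc.chainBonus_nonneg (p + 1) (by omega)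
  rw [MacLane.chainBonus] at hdb
  change (ψ (p + 2 + 1)).natDegree = MacLane.ramIdx ψ lam (p + 2) * (ψ (p + 2)).natDegree at hdeg
  change 2 ≤ MacLane.ramIdx ψ lam (p + 2) at hr
  set r := MacLane.ramIdx ψ lam (p + 2)
  rw [hψlast, hψn] at hdeg
  rw [hψn] at hd2
  change (r : ℚ) * MacLane.chainBonus ψ lam (p + 1) +
    (r - 1) * (r * ((ψ (p + 2)).natDegree * lam (p + 2)) - 1) ≤ _ at hdb
  rw [hψn] at hdb
  have hd2' : (2 : ℚ) ≤ (φ (p + 2)).natDegree := by exact_mod_cast hd2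
  have her : e = r := by
    rw [he, hdeg, Nat.cast_mul, mul_div_cancel_right₀]
    linarith
  -- The degree is at least 2 and the last λ exceeds 1, both because n ≥ 2.
  have hx : 2 < (φ (p + 2)).natDegree * lam (p + 2) := by nlinarith
  set x := (φ (p + 2)).natDegree * lam (p + 2)
  refine ⟨by rw [her]; exact_mod_cast hr, ?_⟩
  rcases hr.eq_or_lt with h2 | h3
  · have hbound : MacLane.bonusBound e x = 2 * x - 1 := by
      rw [MacLane.bonusBound, if_pos (by rw [her, ← h2]; norm_num)]
    rw [← h2] at hdb her
    push_cast at hdb her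
    rw [hbound]
    refine ⟨by linarith, fun heq => ⟨her, ?_⟩⟩
    -- For e = 2 the chain bound exceeds 2x - 1 by twice the previous bonus, so equality kills it.
    have hb0 : MacLane.chainBonus ψ lam (p + 1) = 0 := by linarith
    have hp : p = 0 := by
      by_contra hp
      obtain ⟨q, rfl⟩ := Nat.exists_eq_succ_of_ne_zero hp
      exact (hc.chainBonus_pos (i := q) (by omega)).ne' hb0
    subst hp
    refine ⟨rfl, ?_⟩
    rw [← hψ2]
    refine hc.isEisenstein (by omega) w hw (by rw [hψlast]; exact minpoly.aeval K α) hα ?_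
    have hr1 : (2 : ℚ) ≤ MacLane.ramIdx ψ lam 1 := by
      exact_mod_cast hc.two_le_ramIdx (i := 0) (by omega)
    rw [MacLane.chainBonus, MacLane.chainBonus, mul_zero, zero_add, zero_add, hc.natDegree_one,
      Nat.cast_one, one_mul] at hb0
    -- The vanishing bonus is (r_1 - 1)(r_1 λ_1 - 1), and r_1 ≥ 2 excludes the first factor.
    rcases mul_eq_zero.1 hb0 with h | h <;> linarith
  · have hbound : MacLane.bonusBound e x = 2 * ((⌊x⌋ : ℚ) + r - 1) := by
      rw [MacLane.bonusBound, if_neg, her]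
      rw [her]
      exact_mod_cast h3.ne'
    have hlt := MacLane.bonus_lt_of_three_le h3 hx
    have hrb : 0 ≤ (r : ℚ) * MacLane.chainBonus ψ lam (p + 1) := mul_nonneg (Nat.cast_nonneg _) hb
    rw [hbound]
    -- The inequality is strict here, so equality is contradictory.
    refine ⟨by linarith, fun heq => ?_⟩
    linarith
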